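/- **Setting.** Let $\mathrm{TL}$ be the Temperley–Lieb category over $\mathbb{C}(q)$: the objects are the integers $n\ge 0$, and $\mathrm{TL}(n,m)$ is the $\mathbb{C}(q)$-vector space with basis the planar diagrams without closed circles (crossingless perfect matchings, up to isotopy) joining $n$ points on a lower line and $m$ points on an upper line. The composition $ba\in\mathrm{TL}(n,l)$ of $a\in\mathrm{TL}(n,m)$ and $b\in\mathrm{TL}(m,l)$ is the bilinear extension of stacking $b$ on top of $a$, where each closed circle is removed at the cost of a factor $q+q^{-1}$. Put $\mathrm{TL}_n=\mathrm{TL}(n,n)$. Let $x\mapsto\bar x$, $\mathrm{TL}(n,m)\to\mathrm{TL}(m,n)$, be the $\mathbb{C}(q)$-linear map that turns diagrams upside down, and $x\mapsto x\sqcup 1$, $\mathrm{TL}(n,m)\to\mathrm{TL}(n+1,m+1)$, the linear map that adjoins a vertical strand on the right. The through-degree $\tau(D)$ of a diagram $D\in\mathrm{TL}(n,m)$ is the least $l$ such that $D=cb$ for some $b\in\mathrm{TL}(n,l)$, $c\in\mathrm{TL}(l,m)$; for a linear combination, $\tau(\sum_i f_iD_i)=\max\{\tau(D_i): f_i\neq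 0\}$ (distinct diagrams $D_i$), and $\tau(0)=-\infty$. Write $[k]=(q^k-q^{-k})/(q-q^{-1})$. The Jones–Wenzl projectors are given by $p_0=1$, $p_1=1$ and $$p_n=(p_{n-1}\sqcup 1)-\tfrac{[n-1]}{[n]}(p_{n-1}\sqcup 1)\,e_{n-1}\,(p_{n-1}\sqcup 1)\qquad (n\ge 2),$$ where $e_{n-1}=\cup_{n-2}\,\overline{\cup_{n-2}}\in\mathrm{TL}_n$ and $\cup_{k}\in\mathrm{TL}(k,k+2)$ is the diagram of $k$ vertical strands with a cup on their right. Let $\mathcal{L}_{n,k}$ be the set of sequences $\epsilon=(i_1,\dots,i_n)\in\{-1,1\}^n$ all of whose partial sums are $\ge 0$ and whose sum $|\epsilon|$ is $k$. For $\epsilon\in\mathcal{L}_{n,k}$ define $t_\epsilon\in\mathrm{TL}(k,n)$ and $f_\epsilon\in\mathbb{C}(q)$ inductively, starting with the empty sequence, by $t_{()}=1$, $f_{()}=1$ and, for $|\epsilon|=k$, $$t_{\epsilon\cdot(+1)}=(t_\epsilon\sqcup 1)\,p_{k+1},\qquad t_{\epsilon\cdot(-1)}=(t_\epsilon\sqcup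 1)(p_k\sqcup 1)\,\cup_{k-1},$$ $$f_{\epsilon\cdot(+1)}=f_\epsilon,\qquad f_{\epsilon\cdot(-1)}=\tfrac{[k]}{[k+1]}f_\epsilon .$$ Put $p_\epsilon=f_\epsilon\,t_\epsilon\bar t_\epsilon\in\mathrm{TL}_n$. The $k$th higher order Jones–Wenzl projector is $p_{n,k}=\sum_{\epsilon\in\mathcal{L}_{n,k}}p_\epsilon\in\mathrm{TL}_n$. **Theorem.** Let $0\le k\le n$ with $n-k$ even. An element $p\in\mathrm{TL}_n$ is equal to $p_{n,k}$ if and only if it has the following three properties. 1. $\tau(p)=k$. 2. For each $l\ge 0$ and each $a\in\mathrm{TL}(n,l)$ with $\tau(a)<k$, one has $a\,p=0$ and $p\,\bar a=0$. 3. For each $l\ge 0$ and each $a\in\mathrm{TL}(n,l)$ with $\tau(a)=k$, there is $b\in\mathrm{TL}(n,l)$ with $a\,p=a+b$ and $\tau(b)<k$. In particular $p_{n,k}$ has these properties and is the only element of $\mathrm{TL}_n$ that has them. -/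

import Mathlib

/-! ### Planar diagrams -/

/-- The boundary points of a diagram in a rectangle with `n` points on the bottom edge and `m` points
on the top edge, both numbered from left to right, are listed in counterclockwise order:
bottom edge from left to right, then top edge from right to left. -/
def boundaryPos (n m : ℕ) : Fin n ⊕ Fin m → ℕ
  | Sum.inl i => i
  | Sum.inr j => n + (Fin.rev j : ℕ)

/-- A Temperley–Lieb diagram from `n` points (bottom) to `m` points (top), without closed circles,
up to isotopy: a perfect matching of the boundary points by pairwise non-crossing chords. -/
@[ext]
structure TLDiagram (n m : ℕ) where
  partner : Fin n ⊕ Fin m → Fin n ⊕ Fin m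
  partner_partner : ∀ x, partner (partner x) = x
  partner_ne : ∀ x, partner x ≠ x
  noncrossing : ∀ x y, ¬ (boundaryPos n m x < boundaryPos n m y ∧
    boundaryPos n m y < boundaryPos n m (partner x) ∧
    boundaryPos n m (partner x) < boundaryPos n m (partner y))

namespace TLDiagram

/-- The chords of a diagram, as a graph on its boundary points. -/
def graph {n m : ℕ} (a : TLDiagram n m) : SimpleGraph (Fin n ⊕ Fin m) where
  Adj x y := a.partner x = y
  symm := ⟨fun x y h => by rw [← h, a.partner_partner]⟩
  loopless := ⟨fun x h => a.partner_ne x h⟩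

/-- The identity diagram: `n` vertical chords. -/
def id (n : ℕ) : TLDiagram n n where
  partner := Sum.swap
  partner_partner := Sum.swap_swap
  partner_ne := by rintro (i | i) <;> simp
  noncrossing := by
    rintro (i | i) (j | j) <;>
      simp only [boundaryPos, Sum.swap_inl, Sum.swap_inr, Fin.val_rev] <;> omega

/-- The diagram turned upside down. -/
def flip {n m : ℕ} (a : TLDiagram n m) : TLDiagram m n where
  partner x := (a.partner x.swap).swap
  partner_partner x := by simp [a.partner_partner]
  partner_ne x h := a.partner_ne x.swap (by
    have h' := congrArg Sum.swap h
    rwa [Sum.swap_swap] at h')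
  noncrossing := by
    have key : ∀ x, boundaryPos m n x + boundaryPos n m x.swap + 1 = n + m := by
      rintro (i | i) <;>
        simp only [boundaryPos, Sum.swap_inl, Sum.swap_inr, Fin.val_rev] <;> omega
    intro x y h
    have h1 := key x
    have h2 := key y
    have h3 := key (a.partner x.swap).swap
    have h4 := key (a.partner y.swap).swap
    have h5 := a.noncrossing (a.partner y.swap) (a.partner x.swap)
    simp only [a.partner_partner, Sum.swap_swap] at *
    omega

/-- The partner map of the diagram with one vertical chord adjoined on the right. -/
def addStrandPartner {n m : ℕ} (a : TLDiagram n m) :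
    Fin (n + 1) ⊕ Fin (m + 1) → Fin (n + 1) ⊕ Fin (m + 1)
  | Sum.inl i => Fin.lastCases (motive := fun _ => Fin (n + 1) ⊕ Fin (m + 1))
      (Sum.inr (Fin.last m))
      (fun i => Sum.map Fin.castSucc Fin.castSucc (a.partner (Sum.inl i))) i
  | Sum.inr j => Fin.lastCases (motive := fun _ => Fin (n + 1) ⊕ Fin (m + 1))
      (Sum.inl (Fin.last n))
      (fun j => Sum.map Fin.castSucc Fin.castSucc (a.partner (Sum.inr j))) j

theorem addStrandPartner_map {n m : ℕ} (a : TLDiagram n m) (x : Fin n ⊕ Fin m) :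
    a.addStrandPartner (Sum.map Fin.castSucc Fin.castSucc x) =
      Sum.map Fin.castSucc Fin.castSucc (a.partner x) := by
  rcases x with i | i <;> simp [addStrandPartner]

theorem addStrand_cases {n m : ℕ} (x : Fin (n + 1) ⊕ Fin (m + 1)) :
    (∃ y : Fin n ⊕ Fin m, x = Sum.map Fin.castSucc Fin.castSucc y) ∨
      x = Sum.inl (Fin.last n) ∨ x = Sum.inr (Fin.last m) := by
  rcases x with i | i
  · induction i using Fin.lastCases with
    | last => simp
    | cast i => exact Or.inl ⟨Sum.inl i, rfl⟩
  · induction i using Fin.lastCases with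
    | last => simp
    | cast i => exact Or.inl ⟨Sum.inr i, rfl⟩

theorem boundaryPos_addStrand {n m : ℕ} (x : Fin n ⊕ Fin m) :
    (boundaryPos n m x < n ∧ boundaryPos (n + 1) (m + 1) (Sum.map Fin.castSucc Fin.castSucc x) =
        boundaryPos n m x) ∨
      (n ≤ boundaryPos n m x ∧
        boundaryPos (n + 1) (m + 1) (Sum.map Fin.castSucc Fin.castSucc x) =
          boundaryPos n m x + 2) := by
  rcases x with i | i <;> simp [boundaryPos, Fin.val_rev]
  omega

/-- `a ⊔ 1`: the diagram with one vertical chord adjoined on the right. -/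
def addStrand {n m : ℕ} (a : TLDiagram n m) : TLDiagram (n + 1) (m + 1) where
  partner := a.addStrandPartner
  partner_partner x := by
    rcases addStrand_cases x with ⟨y, rfl⟩ | rfl | rfl
    · simp only [addStrandPartner_map, a.partner_partner]
    · simp [addStrandPartner]
    · simp [addStrandPartner]
  partner_ne x := by
    rcases addStrand_cases x with ⟨y, rfl⟩ | rfl | rfl
    · rw [addStrandPartner_map]
      intro h
      refine a.partner_ne y (Sum.map_injective.2 ⟨?_, ?_⟩ h) <;>
        exact Fin.castSucc_injective _
    · simp [addStrandPartner]
    · simp [addStrandPartner]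
  noncrossing x y := by
    have hl : a.addStrandPartner (Sum.inl (Fin.last n)) = Sum.inr (Fin.last m) := by
      simp [addStrandPartner]
    have hr : a.addStrandPartner (Sum.inr (Fin.last m)) = Sum.inl (Fin.last n) := by
      simp [addStrandPartner]
    have pl : boundaryPos (n + 1) (m + 1) (Sum.inl (Fin.last n)) = n := by simp [boundaryPos]
    have pr : boundaryPos (n + 1) (m + 1) (Sum.inr (Fin.last m)) = n + 1 := by simp [boundaryPos]
    rcases addStrand_cases x with ⟨x, rfl⟩ | rfl | rfl <;>
      rcases addStrand_cases y with ⟨y, rfl⟩ | rfl | rfl <;>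
      simp only [addStrandPartner_map, hl, hr, pl, pr]
    · have := a.noncrossing x y
      have := boundaryPos_addStrand x
      have := boundaryPos_addStrand y
      have := boundaryPos_addStrand (a.partner x)
      have := boundaryPos_addStrand (a.partner y)
      omega
    all_goals omega

/-- `n` vertical chords, followed on the right by a chord (a cup) that joins the last two of the
`n + 2` top points. -/
def cupLast (n : ℕ) : TLDiagram n (n + 2) where
  partner
    | Sum.inl i => Sum.inr i.castSucc.castSucc
    | Sum.inr j => Fin.lastCases (motive := fun _ => Fin n ⊕ Fin (n + 2))
        (Sum.inr (Fin.last n).castSucc)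
        (fun j => Fin.lastCases (motive := fun _ => Fin n ⊕ Fin (n + 2))
          (Sum.inr (Fin.last (n + 1))) (fun i => Sum.inl i) j) j
  partner_partner := by
    rintro (i | j)
    · simp
    · induction j using Fin.lastCases with
      | last => simp
      | cast j =>
        induction j using Fin.lastCases with
        | last => simp
        | cast j => simp
  partner_ne := by
    rintro (i | j)
    · simp
    · induction j using Fin.lastCases with
      | last => simp [Fin.ext_iff]
      | cast j =>
        induction j using Fin.lastCases with
        | last => simp [Fin.ext_iff]
        | cast j => simp
  noncrossing := by
    have cs : ∀ x : Fin n ⊕ Fin (n + 2), (∃ i, x = Sum.inl i) ∨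
        (∃ i : Fin n, x = Sum.inr i.castSucc.castSucc) ∨ x = Sum.inr (Fin.last n).castSucc ∨
        x = Sum.inr (Fin.last (n + 1)) := by
      rintro (i | j)
      · simp
      · induction j using Fin.lastCases with
        | last => simp
        | cast j =>
          induction j using Fin.lastCases with
          | last => simp
          | cast j => simp
    intro x y
    rcases cs x with ⟨i, rfl⟩ | ⟨i, rfl⟩ | rfl | rfl <;>
      rcases cs y with ⟨j, rfl⟩ | ⟨j, rfl⟩ | rfl | rfl <;>
      simp [boundaryPos, Fin.val_rev] <;> omega

/-! ### Stacking -/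

/-- The position of the boundary points of the lower diagram among the three rows of points. -/
def lowerPts (n m l : ℕ) : Fin n ⊕ Fin m ↪ Fin n ⊕ Fin m ⊕ Fin l :=
  Function.Embedding.sumMap (Function.Embedding.refl _) Function.Embedding.inl

/-- The position of the boundary points of the upper diagram among the three rows of points. -/
def upperPts (n m l : ℕ) : Fin m ⊕ Fin l ↪ Fin n ⊕ Fin m ⊕ Fin l :=
  Function.Embedding.inr

/-- The position of the points of the outer rows among the three rows of points. -/
def outerPts (n m l : ℕ) : Fin n ⊕ Fin l ↪ Fin n ⊕ Fin m ⊕ Fin l :=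
  Function.Embedding.sumMap (Function.Embedding.refl _) Function.Embedding.inr

/-- The diagram `b` stacked on top of the diagram `a`, as a graph on three rows of points. -/
def stack {n m l : ℕ} (a : TLDiagram n m) (b : TLDiagram m l) :
    SimpleGraph (Fin n ⊕ Fin m ⊕ Fin l) :=
  a.graph.map (lowerPts n m l) ⊔ b.graph.map (upperPts n m l)

/-- The number of closed circles that arise when `b` is stacked on `a`. -/
noncomputable def loops {n m l : ℕ} (a : TLDiagram n m) (b : TLDiagram m l) : ℕ :=
  Nat.card {C : (stack a b).ConnectedComponent //
    ∀ x : Fin n ⊕ Fin l, (stack a b).connectedComponentMk (outerPts n m l x) ≠ C}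

/-- A non-crossing perfect matching of a set of points on a line. -/
structure IsNC {X : Type} (pos : X → ℕ) (f : X → X) : Prop where
  inv : ∀ x, f (f x) = x
  ne : ∀ x, f x ≠ x
  nc : ∀ x y, ¬ (pos x < pos y ∧ pos y < pos (f x) ∧ pos (f x) < pos (f y))

/-- Joining the points `u` and `v` of a matching: `u` and `v` are matched with each other, and
their former partners with each other. -/
def joinPts {X : Type} [DecidableEq X] (f : X → X) (u v : X) (x : X) : X :=
  if x = u then v else if x = v then u else if x = f u then f v else if x = f v then f u else f x

theorem joinPts_cases {X : Type} [DecidableEq X] (f : X → X) (u v x : X) :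
    (x = u ∧ joinPts f u v x = v) ∨ (x = v ∧ joinPts f u v x = u) ∨
      (x ≠ u ∧ x ≠ v ∧ x = f u ∧ joinPts f u v x = f v) ∨
      (x ≠ u ∧ x ≠ v ∧ x = f v ∧ joinPts f u v x = f u) ∨
      (x ≠ u ∧ x ≠ v ∧ x ≠ f u ∧ x ≠ f v ∧ joinPts f u v x = f x) := by
  unfold joinPts
  split_ifs <;> simp_all

/-- If the chord from `z` to `w` crosses neither the chord from `U` to `A` nor the chord from `V` to
`B`, then it does not cross the chord from `A` to `B` obtained by joining `U` and `V`. -/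
theorem arcs_aux (U V A B z w : ℕ) (huv : U < V) (a1 : A < U ∨ V ≤ A) (b1 : B ≤ U ∨ V < B)
    (hz : z < U ∧ w < U ∨ z < U ∧ V < w ∨ V < z ∧ w < U ∨ V < z ∧ V < w ∨
      U < z ∧ z < V ∧ U < w ∧ w < V)
    (zA : z < A ∨ A < z) (zB : z < B ∨ B < z) (wA : w < A ∨ A < w) (wB : w < B ∨ B < w)
    (h1 : U < z → z < A → U < w ∧ w < A) (h2 : A < z → z < U → A < w ∧ w < U)
    (h3 : V < z → z < B → V < w ∧ w < B) (h4 : B < z → z < V → B < w ∧ w < V)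
    (h1' : U < w → w < A → U < z ∧ z < A) (h2' : A < w → w < U → A < z ∧ z < U)
    (h3' : V < w → w < B → V < z ∧ z < B) (h4' : B < w → w < V → B < z ∧ z < V) :
    (A < z → z < B → A < w ∧ w < B) ∧ (B < z → z < A → B < w ∧ w < A) ∧
      (A < w → w < B → A < z ∧ z < B) ∧ (B < w → w < A → B < z ∧ z < A) := by
  rcases a1 with a | a <;> rcases b1 with b | b <;>
    rcases hz with ⟨h, h'⟩ | ⟨h, h'⟩ | ⟨h, h'⟩ | ⟨h, h'⟩ | ⟨h, h', h'', h'''⟩ <;>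
    refine ⟨?_, ?_, ?_, ?_⟩ <;> intro g g' <;> omega

theorem IsNC.side {X : Type} {pos : X → ℕ} (hpos : Function.Injective pos) {f : X → X}
    (hf : IsNC pos f) (u z : X) (h1 : pos u < pos z) (h2 : pos z < pos (f u)) :
    pos u < pos (f z) ∧ pos (f z) < pos (f u) := by
  have e1 := hf.nc u z
  have e2 := hf.nc (f z) u
  rw [hf.inv] at e2
  have n1 : pos (f z) ≠ pos u := fun h => by
    have := hpos h
    rw [← this, hf.inv] at h2
    omega
  have n2 : pos (f z) ≠ pos (f u) := fun h => by
    have := congrArg f (hpos h)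
    rw [hf.inv, hf.inv] at this
    rw [this] at h1
    omega
  omega

theorem IsNC.joinPts {X : Type} [DecidableEq X] {pos : X → ℕ} (hpos : Function.Injective pos)
    {f : X → X} (hf : IsNC pos f) {u v : X} (huv : pos u < pos v)
    (hbet : ∀ x, pos u < pos x → pos x < pos v → pos u < pos (f x) ∧ pos (f x) < pos v) :
    IsNC pos (TLDiagram.joinPts f u v) := by
  have hne : u ≠ v := fun h => by simp [h] at huv
  have inv := hf.inv
  have ne := hf.ne
  have hne' : f u ≠ f v := fun h => hne (by rw [← inv u, h, inv])
  have cs := joinPts_cases f u v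
  have pne : ∀ x y, x ≠ y → pos x ≠ pos y := fun x y h h' => h (hpos h')
  refine ⟨?_, ?_, ?_⟩
  · intro x
    unfold TLDiagram.joinPts
    grind
  · intro x
    rcases cs x with ⟨h1, h2⟩ | ⟨h1, h2⟩ | ⟨h3, h4, h1, h2⟩ | ⟨h3, h4, h1, h2⟩ |
        ⟨h3, h4, h5, h6, h2⟩ <;> rw [h2]
    · rw [h1]; exact hne.symm
    · rw [h1]; exact hne
    · rw [h1]; exact hne'.symm
    · rw [h1]; exact hne'
    · exact ne x
  · intro x y
    have b1 := hbet (f u)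
    have b2 := hbet (f v)
    rw [inv] at b1 b2
    have n1 := pne _ _ (ne u)
    have n2 := pne _ _ (ne v)
    have n3 := pne _ _ hne'
    have oth : ∀ z, z ≠ u → z ≠ v → z ≠ f u → z ≠ f v →
        (pos (f u) < pos z → pos z < pos (f v) → pos (f u) < pos (f z) ∧ pos (f z) < pos (f v)) ∧
        (pos (f v) < pos z → pos z < pos (f u) → pos (f v) < pos (f z) ∧ pos (f z) < pos (f u)) ∧
        (pos (f u) < pos (f z) → pos (f z) < pos (f v) → pos (f u) < pos z ∧ pos z < pos (f v)) ∧
        (pos (f v) < pos (f z) → pos (f z) < pos (f u) → pos (f v) < pos z ∧ pos z < pos (f u)) ∧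
        (pos z < pos u ∧ pos (f z) < pos u ∨ pos z < pos u ∧ pos v < pos (f z) ∨
          pos v < pos z ∧ pos (f z) < pos u ∨ pos v < pos z ∧ pos v < pos (f z) ∨
          pos u < pos z ∧ pos z < pos v ∧ pos u < pos (f z) ∧ pos (f z) < pos v) := by
      intro z z1 z2 z3 z4
      have m1 := pne _ _ z1
      have m2 := pne _ _ z2
      have m3 := pne _ _ z3
      have m4 := pne _ _ z4
      have m5 : pos (f z) ≠ pos u := pne _ _ fun h => z3 (by rw [← h, inv])
      have m6 : pos (f z) ≠ pos v := pne _ _ fun h => z4 (by rw [← h, inv])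
      have m7 : pos (f z) ≠ pos (f u) := pne _ _ fun h => z1 (by rw [← inv z, h, inv])
      have m8 : pos (f z) ≠ pos (f v) := pne _ _ fun h => z2 (by rw [← inv z, h, inv])
      have c1 := hbet z
      have c2 := hbet (f z)
      rw [inv] at c2
      have s1 := hf.side hpos u z
      have s2 := hf.side hpos (f u) z
      have s3 := hf.side hpos v z
      have s4 := hf.side hpos (f v) z
      have s5 := hf.side hpos u (f z)
      have s6 := hf.side hpos (f u) (f z)
      have s7 := hf.side hpos v (f z)
      have s8 := hf.side hpos (f v) (f z)
      simp only [inv] at s1 s2 s3 s4 s5 s6 s7 s8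
      have hz : pos z < pos u ∧ pos (f z) < pos u ∨ pos z < pos u ∧ pos v < pos (f z) ∨
          pos v < pos z ∧ pos (f z) < pos u ∨ pos v < pos z ∧ pos v < pos (f z) ∨
          pos u < pos z ∧ pos z < pos v ∧ pos u < pos (f z) ∧ pos (f z) < pos v := by
        clear s1 s2 s3 s4 s5 s6 s7 s8
        omega
      obtain ⟨r1, r2, r3, r4⟩ := arcs_aux (pos u) (pos v) (pos (f u)) (pos (f v)) (pos z) (pos (f z))
        huv (by clear hz s1 s2 s3 s4 s5 s6 s7 s8; omega)
        (by clear hz s1 s2 s3 s4 s5 s6 s7 s8; omega) hz (by omega) (by omega) (by omega) (by omega)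
        s1 s2 s3 s4 s5 s6 s7 s8
      exact ⟨r1, r2, r3, r4, hz⟩
    rcases cs x with ⟨h1, h2⟩ | ⟨h1, h2⟩ | ⟨h3, h4, h1, h2⟩ | ⟨h3, h4, h1, h2⟩ |
        ⟨h3, h4, h5, h6, h2⟩ <;>
      rcases cs y with ⟨k1, k2⟩ | ⟨k1, k2⟩ | ⟨k3, k4, k1, k2⟩ | ⟨k3, k4, k1, k2⟩ |
        ⟨k3, k4, k5, k6, k2⟩ <;> rw [h2, k2]
    case inr.inr.inr.inr.inr.inr.inr.inr => exact hf.nc x y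
    all_goals first
      | (rw [h1, k1]; omega)
      | (obtain ⟨r1, r2, r3, r4, r5⟩ := oth x h3 h4 h5 h6
         rw [k1]; omega)
      | (obtain ⟨r1, r2, r3, r4, r5⟩ := oth y k3 k4 k5 k6
         rw [h1]; omega)

/-- The positions of the boundary points of two diagrams, the second listed after the first. -/
def pairPos (n m l : ℕ) : (Fin n ⊕ Fin m) ⊕ (Fin m ⊕ Fin l) → ℕ
  | Sum.inl x => boundaryPos n m x
  | Sum.inr x => n + m + boundaryPos m l x

theorem boundaryPos_lt {n m : ℕ} (x : Fin n ⊕ Fin m) : boundaryPos n m x < n + m := by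
  rcases x with i | i <;> simp only [boundaryPos, Fin.val_rev] <;> omega

theorem boundaryPos_injective (n m : ℕ) : Function.Injective (boundaryPos n m) := by
  rintro (i | i) (j | j) h <;> simp only [boundaryPos, Fin.val_rev] at h
  · exact congrArg _ (Fin.ext h)
  · omega
  · omega
  · exact congrArg _ (Fin.ext (by omega))

theorem pairPos_injective (n m l : ℕ) : Function.Injective (pairPos n m l) := by
  rintro (x | x) (y | y) h <;> simp only [pairPos] at h
  · exact congrArg _ (boundaryPos_injective _ _ h)
  · have := boundaryPos_lt x
    omega
  · have := boundaryPos_lt y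
    omega
  · exact congrArg _ (boundaryPos_injective _ _ (by omega))

/-- The map that identifies the top row of the lower diagram with the bottom row of the upper
diagram. -/
def identify (n m l : ℕ) : (Fin n ⊕ Fin m) ⊕ (Fin m ⊕ Fin l) → Fin n ⊕ Fin m ⊕ Fin l :=
  Sum.elim (lowerPts n m l) (upperPts n m l)

theorem reachable_sumMap {n m l : ℕ} (a : TLDiagram n m) (b : TLDiagram m l)
    (x : (Fin n ⊕ Fin m) ⊕ (Fin m ⊕ Fin l)) :
    (stack a b).Reachable (identify n m l x)
      (identify n m l (Sum.map a.partner b.partner x)) := by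
  apply SimpleGraph.Adj.reachable
  rcases x with x | x
  · exact Or.inl ((SimpleGraph.map_adj _ _ _ _).2 ⟨x, a.partner x, rfl, rfl, rfl⟩)
  · exact Or.inr ((SimpleGraph.map_adj _ _ _ _).2 ⟨x, b.partner x, rfl, rfl, rfl⟩)

/-- Joining the first `s` pairs of middle points. -/
theorem exists_joined {n m l : ℕ} (a : TLDiagram n m) (b : TLDiagram m l) (s : ℕ) (hs : s ≤ m) :
    ∃ g : (Fin n ⊕ Fin m) ⊕ (Fin m ⊕ Fin l) → (Fin n ⊕ Fin m) ⊕ (Fin m ⊕ Fin l),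
      IsNC (pairPos n m l) g ∧
      (∀ j : Fin m, (j : ℕ) < s → g (Sum.inl (Sum.inr j)) = Sum.inr (Sum.inl j)) ∧
      (∀ x, (stack a b).Reachable (identify n m l x) (identify n m l (g x))) ∧
      ∀ c : (Fin n ⊕ Fin m) ⊕ (Fin m ⊕ Fin l) → Set ((Fin n ⊕ Fin m) ⊕ (Fin m ⊕ Fin l)),
        (∀ x, c (g x) = c x) → (∀ j, c (Sum.inl (Sum.inr j)) = c (Sum.inr (Sum.inl j))) →
        ∃ c' : (Fin n ⊕ Fin m) ⊕ (Fin m ⊕ Fin l) → Set ((Fin n ⊕ Fin m) ⊕ (Fin m ⊕ Fin l)),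
          (∀ x, c' (Sum.map a.partner b.partner x) = c' x) ∧
          (∀ j, c' (Sum.inl (Sum.inr j)) = c' (Sum.inr (Sum.inl j))) ∧
          (∀ i, c' (Sum.inl (Sum.inl i)) = c (Sum.inl (Sum.inl i))) ∧
          (∀ i, c' (Sum.inr (Sum.inr i)) = c (Sum.inr (Sum.inr i))) := by
  induction s with
  | zero =>
    refine ⟨Sum.map a.partner b.partner, ⟨?_, ?_, ?_⟩, by simp, reachable_sumMap a b,
      fun c h1 h2 => ⟨c, h1, h2, fun _ => rfl, fun _ => rfl⟩⟩
    · rintro (x | x) <;> simp [a.partner_partner, b.partner_partner]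
    · rintro (x | x) <;> simp [a.partner_ne, b.partner_ne]
    · rintro (x | x) (y | y) <;> simp only [Sum.map_inl, Sum.map_inr, pairPos]
      · exact a.noncrossing x y
      · have := boundaryPos_lt (a.partner x)
        omega
      · have := boundaryPos_lt y
        omega
      · have := b.noncrossing x y
        omega
  | succ s ih =>
    obtain ⟨f, hf, hj, hr, hc⟩ := ih (by omega)
    set j₀ : Fin m := ⟨s, by omega⟩ with hj₀
    set u : (Fin n ⊕ Fin m) ⊕ (Fin m ⊕ Fin l) := Sum.inl (Sum.inr j₀) with hu
    set v : (Fin n ⊕ Fin m) ⊕ (Fin m ⊕ Fin l) := Sum.inr (Sum.inl j₀) with hv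
    have pu : ∀ j : Fin m, pairPos n m l (Sum.inl (Sum.inr j)) = n + (m - (j + 1)) := fun j => by
      simp [pairPos, boundaryPos, Fin.val_rev]
    have pv : ∀ j : Fin m, pairPos n m l (Sum.inr (Sum.inl j)) = n + m + j := fun j => by
      simp [pairPos, boundaryPos]
    have hj' : ∀ j : Fin m, (j : ℕ) < s → f (Sum.inr (Sum.inl j)) = Sum.inl (Sum.inr j) :=
      fun j h => by rw [← hj j h, hf.inv]
    have huv : identify n m l u = identify n m l v := rfl
    have fne : ∀ x, f x = v → x = f v := fun x h => by rw [← h, hf.inv]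
    refine ⟨joinPts f u v, hf.joinPts (pairPos_injective n m l) ?_ ?_, ?_, ?_, ?_⟩
    · rw [hu, hv, pu, pv, hj₀]
      simp only
      omega
    · intro x h1 h2
      rw [hu, pu, hj₀] at h1
      rw [hv, pv, hj₀] at h2
      simp only at h1 h2
      rw [hu, hv, pu, pv, hj₀]
      simp only
      rcases x with (i | j) | (j | i)
      · simp only [pairPos, boundaryPos] at h1
        omega
      · rw [pu] at h1
        have := j.2
        rw [hj j (by omega), pv]
        omega
      · rw [pv] at h2
        have := j.2
        rw [hj' j (by omega), pu]
        omega
      · simp only [pairPos, boundaryPos] at h2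
        omega
    · intro j hjs
      by_cases hjj : j = j₀
      · subst hjj
        simp [joinPts, hu, hv]
      · have hlt : (j : ℕ) < s := by
          have : (j : ℕ) ≠ s := fun h => hjj (Fin.ext h)
          omega
        have e := hj j hlt
        have e' := hj' j hlt
        rcases joinPts_cases f u v (Sum.inl (Sum.inr j)) with ⟨h1, _⟩ | ⟨h1, _⟩ | ⟨_, _, h1, _⟩ |
            ⟨_, _, h1, _⟩ | ⟨_, _, _, _, h2⟩
        · simp [hu, hjj] at h1
        · simp [hv] at h1
        · rw [h1, hf.inv] at e
          simp [hu] at e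
        · rw [h1, hf.inv] at e
          simp only [hv, Sum.inr.injEq, Sum.inl.injEq] at e
          exact absurd e.symm hjj
        · rw [h2, e]
    · intro x
      rcases joinPts_cases f u v x with ⟨h1, h2⟩ | ⟨h1, h2⟩ | ⟨_, _, h1, h2⟩ |
            ⟨_, _, h1, h2⟩ | ⟨_, _, _, _, h2⟩ <;> rw [h2]
      · rw [h1, huv]
      · rw [h1, huv]
      · rw [h1]
        exact ((hr u).symm.trans (huv ▸ SimpleGraph.Reachable.refl _)).trans (hr v)
      · rw [h1]
        exact ((hr v).symm.trans (huv ▸ SimpleGraph.Reachable.refl _)).trans (hr u)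
      · exact hr x
    · intro c h1 h2
      have hne : u ≠ v := by simp [hu, hv]
      have hcuv : c (f u) = c (f v) := by
        rcases joinPts_cases f u v (f u) with ⟨k1, _⟩ | ⟨k1, _⟩ | ⟨_, _, k1, k2⟩ |
            ⟨_, _, k1, k2⟩ | ⟨_, _, k1, _⟩
        · exact absurd k1 (hf.ne u)
        · have : f v = u := by rw [← k1, hf.inv]
          rw [k1, this]
          exact (h2 j₀).symm
        · rw [← h1 (f u), k2]
        · exact congrArg c k1
        · exact absurd rfl k1
      refine (hc (fun x => if x = u ∨ x = v then c (f u) else c x) ?_ ?_).imp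
        fun c' hc' => ⟨hc'.1, hc'.2.1, fun i => ?_, fun i => ?_⟩
      · intro x
        by_cases hxu : x = u
        · rw [hxu]
          simp
        · by_cases hxv : x = v
          · rw [hxv]
            simp [hcuv]
          · by_cases hfu : f x = u
            · have : x = f u := by rw [← hfu, hf.inv]
              simp only [hfu, true_or, if_true, hxu, hxv, or_self, if_false]
              rw [this]
            · by_cases hfv : f x = v
              · have : x = f v := fne x hfv
                simp only [hfv, or_true, if_true, hxu, hxv, or_self, if_false]
                rw [this, hcuv]
              · simp only [hfu, hfv, hxu, hxv, or_self, if_false]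
                rw [← h1 x]
                rcases joinPts_cases f u v x with ⟨k1, _⟩ | ⟨k1, _⟩ | ⟨_, _, k1, _⟩ |
                    ⟨_, _, k1, _⟩ | ⟨_, _, _, _, k2⟩
                · exact absurd k1 hxu
                · exact absurd k1 hxv
                · exact absurd (by rw [k1, hf.inv]) hfu
                · exact absurd (by rw [k1, hf.inv]) hfv
                · rw [k2]
      · intro j
        by_cases hjj : j = j₀
        · simp [hu, hv, hjj]
        · simp [hu, hv, hjj, h2 j]
      · rw [hc'.2.2.1]
        simp [hu, hv]
      · rw [hc'.2.2.2]
        simp [hu, hv]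

/-- When two diagrams are stacked, each point of the outer rows is connected with exactly one other
point of the outer rows, and the resulting matching is non-crossing. -/
theorem exists_comp {n m l : ℕ} (a : TLDiagram n m) (b : TLDiagram m l) :
    ∃ d : TLDiagram n l, ∀ x y, d.partner x = y ↔
      x ≠ y ∧ (stack a b).Reachable (outerPts n m l x) (outerPts n m l y) := by
  obtain ⟨g, hg, hj, hr, hc⟩ := exists_joined a b m le_rfl
  have hj' : ∀ j, g (Sum.inr (Sum.inl j)) = Sum.inl (Sum.inr j) :=
    fun j => by rw [← hj j j.2, hg.inv]
  let o : Fin n ⊕ Fin l → (Fin n ⊕ Fin m) ⊕ (Fin m ⊕ Fin l) := Sum.map Sum.inl Sum.inr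
  have ho : Function.Injective o := Sum.map_injective.2 ⟨Sum.inl_injective, Sum.inr_injective⟩
  have oid : ∀ x, identify n m l (o x) = outerPts n m l x := by
    rintro (x | x) <;> rfl
  have hout : ∀ x, ∃ y, o y = g (o x) := by
    intro x
    rcases h : g (o x) with (i | j) | (j | i)
    · exact ⟨Sum.inl i, rfl⟩
    · have := hg.inv (o x)
      rw [h, hj j j.2] at this
      rcases x with x | x <;> simp [o] at this
    · have := hg.inv (o x)
      rw [h, hj' j] at this
      rcases x with x | x <;> simp [o] at this
    · exact ⟨Sum.inr i, rfl⟩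
  choose h hh using hout
  have hpos : ∀ x, (boundaryPos n l x < n ∧ pairPos n m l (o x) = boundaryPos n l x) ∨
      (n ≤ boundaryPos n l x ∧ pairPos n m l (o x) = boundaryPos n l x + (m + m)) := by
    rintro (x | x) <;> simp only [o, Sum.map_inl, Sum.map_inr, pairPos, boundaryPos, Fin.val_rev]
    · exact Or.inl ⟨x.2, trivial⟩
    · exact Or.inr ⟨by omega, by omega⟩
  refine ⟨⟨h, fun x => ho (by rw [hh, hh, hg.inv]), fun x e => hg.ne (o x) (by rw [← hh, e]),
    fun x y => ?_⟩, fun x y => ⟨?_, ?_⟩⟩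
  · have e := hg.nc (o x) (o y)
    rw [← hh, ← hh] at e
    have := hpos x
    have := hpos y
    have := hpos (h x)
    have := hpos (h y)
    omega
  · rintro rfl
    refine ⟨fun e => hg.ne (o x) (by rw [← hh]; exact congrArg o e.symm), ?_⟩
    have := hr (o x)
    rwa [← hh, oid, oid] at this
  · rintro ⟨hxy, hreach⟩
    obtain ⟨c, c1, c2, c3, c4⟩ := hc (fun z => {z, g z})
      (fun z => by rw [hg.inv, Set.pair_comm]) (fun j => by rw [hj j j.2, hj' j, Set.pair_comm])
    have c5 : ∀ z, c (o z) = {o z, g (o z)} := by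
      rintro (z | z)
      · exact c3 z
      · exact c4 z
    let c₃ : Fin n ⊕ Fin m ⊕ Fin l → Set ((Fin n ⊕ Fin m) ⊕ (Fin m ⊕ Fin l)) :=
      Sum.elim (fun i => c (Sum.inl (Sum.inl i))) (fun z => c (Sum.inr z))
    have hc₃ : ∀ z, c₃ (identify n m l z) = c z := by
      rintro ((z | z) | z)
      · rfl
      · exact (c2 z).symm
      · rfl
    have hadj : ∀ z w, (stack a b).Adj z w → c₃ z = c₃ w := by
      rintro z w (e | e)
      · obtain ⟨p, q, e1, rfl, rfl⟩ := (SimpleGraph.map_adj _ _ _ _).1 e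
        have e2 : a.partner p = q := e1
        have := c1 (Sum.inl p)
        rw [← hc₃, ← hc₃] at this
        rw [← e2]
        exact this.symm
      · obtain ⟨p, q, e1, rfl, rfl⟩ := (SimpleGraph.map_adj _ _ _ _).1 e
        have e2 : b.partner p = q := e1
        have := c1 (Sum.inr p)
        rw [← hc₃, ← hc₃] at this
        rw [← e2]
        exact this.symm
    have hre : ∀ z w, (stack a b).Reachable z w → c₃ z = c₃ w := by
      rintro z w ⟨p⟩
      induction p with
      | nil => rfl
      | cons e _ ih => exact (hadj _ _ e).trans ih
    have e := hre _ _ hreach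
    rw [← oid, ← oid, hc₃, hc₃, c5, c5] at e
    have hy : o y ∈ ({o x, g (o x)} : Set _) := by
      rw [e]
      simp
    rcases hy with hy | hy
    · exact absurd (ho hy).symm hxy
    · exact ho (by rw [hh]; exact hy.symm)

/-- The diagram obtained by stacking `b` on top of `a` and erasing the closed circles: two distinct
points of the outer rows are joined by a chord if and only if they are connected in the stack. -/
noncomputable def comp {n m l : ℕ} (a : TLDiagram n m) (b : TLDiagram m l) : TLDiagram n l :=
  (exists_comp a b).choose

theorem comp_partner_eq_iff {n m l : ℕ} (a : TLDiagram n m) (b : TLDiagram m l)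
    (x y : Fin n ⊕ Fin l) : (comp a b).partner x = y ↔
      x ≠ y ∧ (stack a b).Reachable (outerPts n m l x) (outerPts n m l y) :=
  (exists_comp a b).choose_spec x y

end TLDiagram

/-! ### The Temperley–Lieb category -/

/-- The variable `q` of the field `ℂ(q)`. -/
noncomputable def qVar : RatFunc ℂ := RatFunc.X

/-- The quantum integer `[k] = (q ^ k - q ^ (-k)) / (q - q ^ (-1))`. -/
noncomputable def quantumInt (k : ℤ) : RatFunc ℂ :=
  (qVar ^ k - qVar ^ (-k)) / (qVar - qVar⁻¹)

/-- The space of morphisms `TL(n, m)`: linear combinations over `ℂ(q)` of diagrams from `n` points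
to `m` points. -/
abbrev TL (n m : ℕ) : Type := TLDiagram n m →₀ RatFunc ℂ

namespace TL

/-- A diagram as a morphism. -/
noncomputable def ofDiagram {n m : ℕ} (D : TLDiagram n m) : TL n m := Finsupp.single D 1

/-- The identity `1_n`. -/
noncomputable def one (n : ℕ) : TL n n := ofDiagram (TLDiagram.id n)

/-- The composition `b a` of `a ∈ TL(n, m)` and `b ∈ TL(m, l)`: the bilinear extension of stacking
`b` on top of `a`, where each closed circle is removed at the cost of a factor `q + q⁻¹`. -/
noncomputable def comp {n m l : ℕ} (b : TL m l) (a : TL n m) : TL n l :=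
  b.sum fun E y => a.sum fun D x =>
    (y * x * (qVar + qVar⁻¹) ^ TLDiagram.loops D E) • ofDiagram (TLDiagram.comp D E)

/-- The reflection `x ↦ x̄`: all diagrams are turned upside down. -/
noncomputable def bar {n m : ℕ} (a : TL n m) : TL m n := Finsupp.mapDomain TLDiagram.flip a

/-- The operation `x ↦ x ⊔ 1`: a vertical strand is adjoined on the right of all diagrams. -/
noncomputable def addStrand {n m : ℕ} (a : TL n m) : TL (n + 1) (m + 1) :=
  Finsupp.mapDomain TLDiagram.addStrand a

/-- The diagram of `n` vertical strands with a cup on their right, as a morphism. -/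
noncomputable def cupLast (n : ℕ) : TL n (n + 2) := ofDiagram (TLDiagram.cupLast n)

/-- The last elementary diagram `e_{n+1} ∈ TL_{n+2}`: `n` vertical strands and on their right a cap
below a cup. -/
noncomputable def eLast (n : ℕ) : TL (n + 2) (n + 2) := comp (cupLast n) (bar (cupLast n))

/-- The through-degree of a diagram `D`: the least `l` such that `D = c b` for some
`b ∈ TL(n, l)` and `c ∈ TL(l, m)`. -/
noncomputable def diagramThroughDegree {n m : ℕ} (D : TLDiagram n m) : ℕ :=
  sInf {l : ℕ | ∃ (b : TL n l) (c : TL l m), ofDiagram D = comp c b}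

/-- The through-degree of a linear combination of diagrams: the maximum of the through-degrees of
the diagrams that occur with a non-zero coefficient; it is `⊥` (that is, `-∞`) for `0`. -/
noncomputable def throughDegree {n m : ℕ} (a : TL n m) : WithBot ℕ :=
  a.support.sup fun D => (diagramThroughDegree D : WithBot ℕ)

/-- The Jones–Wenzl projector `p_n`, by Wenzl's recurrence
`p_n = p_{n-1} - [n-1]/[n] p_{n-1} e_{n-1} p_{n-1}`. -/
noncomputable def jonesWenzl : (n : ℕ) → TL n n
  | 0 => one 0
  | 1 => one 1
  | n + 2 => addStrand (jonesWenzl (n + 1)) -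
      (quantumInt (n + 1) / quantumInt (n + 2)) •
        comp (addStrand (jonesWenzl (n + 1))) (comp (eLast n) (addStrand (jonesWenzl (n + 1))))

end TL

/-! ### Higher order Jones–Wenzl projectors -/

/-- Sequences of length `n` with entries in `{-1, 1}`. -/
abbrev SignSeq (n : ℕ) : Type := Fin n → ℤˣ

namespace SignSeq

/-- The size `|ε| = i_1 + ⋯ + i_n`. -/
def size {n : ℕ} (ε : SignSeq n) : ℤ := ∑ i, (ε i : ℤ)

/-- `ε` is admissible when all its partial sums are non-negative. -/
def Admissible {n : ℕ} (ε : SignSeq n) : Prop := ∀ j : Fin n, 0 ≤ ∑ i ∈ Finset.Iic j, (ε i : ℤ)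

instance {n : ℕ} (ε : SignSeq n) : Decidable ε.Admissible :=
  inferInstanceAs (Decidable (∀ j : Fin n, 0 ≤ ∑ i ∈ Finset.Iic j, (ε i : ℤ)))

/-- The set `L_{n,k}` of admissible sequences of length `n` and size `k`. -/
def admissible (n k : ℕ) : Finset (SignSeq n) :=
  Finset.univ.filter fun ε => ε.Admissible ∧ ε.size = k

end SignSeq

namespace TL

/-- The top half `t_ε ∈ TL(k, n)` for `ε ∈ L_{n,k}`:
`t_{ε·(+1)} = (t_ε ⊔ 1) p_{k+1}` and `t_{ε·(-1)} = (t_ε ⊔ 1) (p_k ⊔ 1) (1_{k-1} ⊔ cup)`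
for `k = |ε|`. (The value is irrelevant, and `0`, if `ε` is not in `L_{n,k}`.) -/
noncomputable def topHalf : (n : ℕ) → (k : ℕ) → SignSeq n → TL k n
  | 0, 0, _ => one 0
  | 0, _ + 1, _ => 0
  | n + 1, k, ε =>
    if ε (Fin.last n) = 1 then
      match k with
      | 0 => 0
      | k + 1 => comp (addStrand (topHalf n k (Fin.init ε))) (jonesWenzl (k + 1))
    else
      comp (addStrand (topHalf n (k + 1) (Fin.init ε)))
        (comp (addStrand (jonesWenzl (k + 1))) (cupLast k))

/-- The special element `q_ε = t_ε t̄_ε ∈ TL_n` for `ε ∈ L_{n,k}`. -/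
noncomputable def specialElement (n k : ℕ) (ε : SignSeq n) : TL n n :=
  comp (topHalf n k ε) (bar (topHalf n k ε))

/-- The scalars `f_ε`: `f_{ε·(+1)} = f_ε` and `f_{ε·(-1)} = f_ε [k]/[k+1]` for `k = |ε|`. -/
noncomputable def scalar : (n : ℕ) → SignSeq n → RatFunc ℂ
  | 0, _ => 1
  | n + 1, ε =>
    if ε (Fin.last n) = 1 then scalar n (Fin.init ε)
    else scalar n (Fin.init ε) *
      (quantumInt (SignSeq.size (n := n) (Fin.init ε)) /
        quantumInt (SignSeq.size (n := n) (Fin.init ε) + 1))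

/-- The idempotent `p_ε = f_ε q_ε` for `ε ∈ L_{n,k}`. -/
noncomputable def seqProjector (n k : ℕ) (ε : SignSeq n) : TL n n :=
  scalar n ε • specialElement n k ε

/-- The higher order Jones–Wenzl projector `p_{n,k}`, the sum of the `p_ε` with `ε ∈ L_{n,k}`. -/
noncomputable def higherJonesWenzl (n k : ℕ) : TL n n :=
  ∑ ε ∈ SignSeq.admissible n k, seqProjector n k ε

end TL

/-! Everything follows from three facts: the `p_{n,k}` with `0 ≤ k ≤ n` sum to `1_n`; `τ(p_{n,k}) ≤
k`; and `p_{n,k}` is annihilated on both sides by everything of through-degree less than `k`.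

If `τ(a) ≤ k`, then in `a = ∑ j, a p_{n,j}` the terms with `j > k` vanish, and those with `j < k`
have through-degree less than `k`; hence `a p_{n,k} = a + b` with `τ(b) < k`. Since `n - k` is even,
some `a` has through-degree exactly `k`, and this forces `τ(p_{n,k}) = k`. For uniqueness, let `d =
p - p_{n,k}`. The same decomposition, applied on the left, gives `d = p_{n,k} d`, while property 3
for `a = p_{n,k}` shows that `p_{n,k} d` has through-degree less than `k`. So `d` is killed by
`p_{n,k}`, and `d = 0`.

The sum formula (`sum_higherJonesWenzl`) is Wenzl's recurrence in disguise: sandwiched between `t_ε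
⊔ 1` and its reflection, it reads `p_ε ⊔ 1 = p_{ε·(+1)} + p_{ε·(-1)}`. The annihilation follows from
`p_ε = f_ε t_ε p_k t̄_ε` and the fact that `p_k` kills every diagram that factors through fewer than
`k` points (`jonesWenzl_comp_of_lt`). This last fact rests on the partial trace of `p_k` and on the
existence of a cup joining two neighbouring points.

The category laws come from a representation with loop value `2`. A diagram acts as the `0`-`1`
matrix of its compatible `2`-colourings, stacking becomes the matrix product, and each closed circle
contributes a factor `2`. The matrix determines the diagram and the power of `2` the number of
circles, so every identity between composites, circles included, reduces to an identity of matrices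
(`colorMatrix_mul`, `comp_eq_of_colorMatrix`). -/

namespace TLDiagram

/-! ### Colouring matrices: a faithful model of stacking -/

/-- The matrix of the `2`-colourings of the boundary points that are constant on the chords. -/
def colorMatrix {n m : ℕ} (a : TLDiagram n m) : Matrix (Fin n → Bool) (Fin m → Bool) ℕ :=
  fun x y => if ∀ z, Sum.elim x y (a.partner z) = Sum.elim x y z then 1 else 0

/-- Single out one chord of `a` by its colour: the colouring is compatible with `a`, hence with `b`,
and so `b` contains the same chord. -/
theorem colorMatrix_injective (n m : ℕ) :
    Function.Injective (colorMatrix : TLDiagram n m → _) := by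
  intro a b h
  ext1
  funext z
  let c : Fin n ⊕ Fin m → Bool := fun w => decide (w = z ∨ w = a.partner z)
  have hc : Sum.elim (c ∘ Sum.inl) (c ∘ Sum.inr) = c := Sum.elim_comp_inl_inr c
  have h1 := congrFun (congrFun h (c ∘ Sum.inl)) (c ∘ Sum.inr)
  simp only [colorMatrix, hc] at h1
  have ha : ∀ w, c (a.partner w) = c w := by
    intro w
    have e1 : a.partner w = z ↔ w = a.partner z :=
      ⟨fun e => by rw [← e, a.partner_partner], fun e => by rw [e, a.partner_partner]⟩
    have e2 : a.partner w = a.partner z ↔ w = z :=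
      ⟨fun e => by rw [← a.partner_partner w, e, a.partner_partner], fun e => by rw [e]⟩
    simp only [c, e1, e2, or_comm]
  rw [if_pos ha] at h1
  have hb : ∀ w, c (b.partner w) = c w := by
    by_contra hn
    rw [if_neg hn] at h1
    exact one_ne_zero h1
  have h2 := hb z
  simp only [c, true_or, decide_true, decide_eq_true_eq] at h2
  exact (h2.resolve_left (b.partner_ne z)).symm

/-- This normalised entry lets a power of `2` in front of a colouring matrix be recovered. -/
theorem colorMatrix_const {n m : ℕ} (a : TLDiagram n m) :
    colorMatrix a (fun _ => true) (fun _ => true) = 1 := by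
  rw [colorMatrix, if_pos]
  intro z
  rcases z with z | z <;> rcases a.partner _ with w | w <;> rfl

theorem stack_coloring_iff {n m l : ℕ} (a : TLDiagram n m) (b : TLDiagram m l) (x : Fin n → Bool)
    (y : Fin m → Bool) (z : Fin l → Bool) :
    ((∀ w, Sum.elim x y (a.partner w) = Sum.elim x y w) ∧
      ∀ w, Sum.elim y z (b.partner w) = Sum.elim y z w) ↔
    ∀ v w, (stack a b).Reachable v w →
      Sum.elim x (Sum.elim y z) v = Sum.elim x (Sum.elim y z) w := by
  have hl : ∀ w, Sum.elim x (Sum.elim y z) (lowerPts n m l w) = Sum.elim x y w := by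
    rintro (w | w) <;> rfl
  have hu : ∀ w, Sum.elim x (Sum.elim y z) (upperPts n m l w) = Sum.elim y z w := by
    rintro (w | w) <;> rfl
  constructor
  · rintro ⟨ha, hb⟩ v w ⟨p⟩
    induction p with
    | nil => rfl
    | cons e _ ih =>
      rw [← ih]
      rcases e with e | e
      · obtain ⟨p, q, e1, rfl, rfl⟩ := (SimpleGraph.map_adj _ _ _ _).1 e
        have e2 : a.partner p = q := e1
        rw [hl, hl, ← e2, ha]
      · obtain ⟨p, q, e1, rfl, rfl⟩ := (SimpleGraph.map_adj _ _ _ _).1 e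
        have e2 : b.partner p = q := e1
        rw [hu, hu, ← e2, hb]
  · intro h
    constructor
    · intro w
      rw [← hl, ← hl]
      exact (h _ _ (reachable_sumMap a b (Sum.inl w))).symm
    · intro w
      rw [← hu, ← hu]
      exact (h _ _ (reachable_sumMap a b (Sum.inr w))).symm

/-- The components that meet the outer rows have their colour prescribed, consistently because the
outer colouring respects the composite. The other components are the closed circles, and each takes
either colour freely. -/
theorem card_stack_colorings {n m l : ℕ} (a : TLDiagram n m) (b : TLDiagram m l)
    (x : Fin n → Bool) (z : Fin l → Bool)
    (h : ∀ w, Sum.elim x z ((comp a b).partner w) = Sum.elim x z w) :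
    Nat.card {y : Fin m → Bool // ∀ v w, (stack a b).Reachable v w →
      Sum.elim x (Sum.elim y z) v = Sum.elim x (Sum.elim y z) w} = 2 ^ loops a b := by
  classical
  set G := stack a b
  let Inner := {C : G.ConnectedComponent //
    ∀ x : Fin n ⊕ Fin l, G.connectedComponentMk (outerPts n m l x) ≠ C}
  have hout : ∀ (y : Fin m → Bool) w,
      Sum.elim x (Sum.elim y z) (outerPts n m l w) = Sum.elim x z w := by
    rintro y (w | w) <;> rfl
  have hex : ∀ C : G.ConnectedComponent,
      (¬ ∀ x : Fin n ⊕ Fin l, G.connectedComponentMk (outerPts n m l x) ≠ C) →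
      ∃ x : Fin n ⊕ Fin l, G.connectedComponentMk (outerPts n m l x) = C := by
    intro C hC
    by_contra hn
    exact hC fun x hx => hn ⟨x, hx⟩
  -- A colouring of the closed circles, extended to all components by the prescribed outer colours;
  -- well defined by `key` below.
  let f : (Inner → Bool) → G.ConnectedComponent → Bool := fun g C =>
    if hC : ∀ x : Fin n ⊕ Fin l, G.connectedComponentMk (outerPts n m l x) ≠ C then g ⟨C, hC⟩
    else Sum.elim x z (hex C hC).choose
  have hf : ∀ g w, f g (G.connectedComponentMk (outerPts n m l w)) = Sum.elim x z w := by
    intro g w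
    have hC : ¬ ∀ x : Fin n ⊕ Fin l, G.connectedComponentMk (outerPts n m l x) ≠
      G.connectedComponentMk (outerPts n m l w) := fun hn => hn w rfl
    simp only [f, dif_neg hC]
    have key : ∀ v, G.Reachable (outerPts n m l v) (outerPts n m l w) →
        Sum.elim x z v = Sum.elim x z w := by
      intro v hv
      by_cases hvw : v = w
      · rw [hvw]
      · rw [← (comp_partner_eq_iff a b _ _).2 ⟨hvw, hv⟩, h]
    exact key _ (SimpleGraph.ConnectedComponent.exact (hex _ hC).choose_spec)
  let Y : (Inner → Bool) → Fin m → Bool := fun g j =>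
    f g (G.connectedComponentMk (Sum.inr (Sum.inl j)))
  have hY : ∀ g v, Sum.elim x (Sum.elim (Y g) z) v = f g (G.connectedComponentMk v) := by
    rintro g (v | v | v)
    · exact (hf g (Sum.inl v)).symm
    · rfl
    · exact (hf g (Sum.inr v)).symm
  have hcard : loops a b = Nat.card Inner := rfl
  have : Finite G.ConnectedComponent := Quot.finite _
  have : Fintype Inner := Fintype.ofFinite _
  have hpow : Nat.card (Inner → Bool) = 2 ^ loops a b := by
    rw [hcard, Nat.card_fun]
    simp
  rw [← hpow]
  refine Nat.card_congr ⟨fun y C => C.1.lift (Sum.elim x (Sum.elim y.1 z))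
    (fun v w p _ => y.2 v w p.reachable), fun g => ⟨Y g, fun v w r => ?_⟩, ?_, ?_⟩
  · rw [hY, hY, SimpleGraph.ConnectedComponent.sound r]
  · rintro ⟨y, hy⟩
    apply Subtype.ext
    funext j
    simp only [Y, f]
    split_ifs with hC
    · rfl
    · rw [← hout y]
      exact hy _ _ (SimpleGraph.ConnectedComponent.exact (hex _ hC).choose_spec)
  · intro g
    funext ⟨C, hC⟩
    induction C using SimpleGraph.ConnectedComponent.ind with
    | h v =>
      change Sum.elim x (Sum.elim (Y g) z) v = _
      rw [hY]
      simp only [f, dif_pos hC]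

/-- An entry of the product counts the colourings of the middle row that extend the given outer
colours to the whole stack. -/
theorem colorMatrix_mul {n m l : ℕ} (a : TLDiagram n m) (b : TLDiagram m l) :
    colorMatrix a * colorMatrix b = 2 ^ loops a b • colorMatrix (comp a b) := by
  classical
  ext x z
  rw [Matrix.mul_apply, Matrix.smul_apply]
  have h1 : ∀ y, colorMatrix a x y * colorMatrix b y z =
      if ∀ v w, (stack a b).Reachable v w →
        Sum.elim x (Sum.elim y z) v = Sum.elim x (Sum.elim y z) w then 1 else 0 := by
    intro y
    rw [← if_congr (stack_coloring_iff a b x y z) rfl rfl]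
    unfold colorMatrix
    rw [ite_and, ite_mul, one_mul, zero_mul]
  simp only [h1]
  rw [Finset.sum_boole, colorMatrix, ← Fintype.card_subtype, ← Nat.card_eq_fintype_card]
  split_ifs with h
  · rw [card_stack_colorings a b x z h]
    simp
  -- A colouring of the stack is constant on components, so its restriction to the outer rows
  -- respects the composite.
  · have : IsEmpty {y : Fin m → Bool // ∀ v w, (stack a b).Reachable v w →
        Sum.elim x (Sum.elim y z) v = Sum.elim x (Sum.elim y z) w} := by
      refine ⟨fun ⟨y, hy⟩ => h fun w => ?_⟩
      have := hy _ _ ((comp_partner_eq_iff a b w _).1 rfl).2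
      rcases w with w | w <;> rcases e : (comp a b).partner _ with v | v <;> rw [e] at this <;>
        exact this.symm
    rw [Nat.card_of_isEmpty, smul_zero, Nat.cast_zero]

theorem pow_smul_colorMatrix_inj {n m r s : ℕ} {a b : TLDiagram n m}
    (h : 2 ^ r • colorMatrix a = 2 ^ s • colorMatrix b) : r = s ∧ a = b := by
  have h1 := congrFun (congrFun h fun _ => true) fun _ => true
  rw [Matrix.smul_apply, Matrix.smul_apply, colorMatrix_const, colorMatrix_const, smul_eq_mul,
    smul_eq_mul, mul_one, mul_one] at h1
  refine ⟨Nat.pow_right_injective le_rfl h1, colorMatrix_injective n m ?_⟩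
  rw [h1] at h
  exact smul_right_injective _ (pow_ne_zero s two_ne_zero) h

/-- Composites of diagrams can be read off from products of colouring matrices. -/
theorem comp_eq_of_colorMatrix {n m l r : ℕ} {a : TLDiagram n m} {b : TLDiagram m l}
    {c : TLDiagram n l} (h : colorMatrix a * colorMatrix b = 2 ^ r • colorMatrix c) :
    loops a b = r ∧ comp a b = c :=
  pow_smul_colorMatrix_inj ((colorMatrix_mul a b).symm.trans h)

/-- Associativity of matrix multiplication gives both the equality of diagrams and the equality of
circle counts. -/
theorem comp_assoc {n m l k : ℕ} (a : TLDiagram n m) (b : TLDiagram m l) (c : TLDiagram l k) :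
    loops a b + loops (comp a b) c = loops b c + loops a (comp b c) ∧
      comp (comp a b) c = comp a (comp b c) := by
  apply pow_smul_colorMatrix_inj
  have h := Matrix.mul_assoc (colorMatrix a) (colorMatrix b) (colorMatrix c)
  rw [colorMatrix_mul, colorMatrix_mul, Matrix.smul_mul, Matrix.mul_smul, colorMatrix_mul,
    colorMatrix_mul, smul_smul, smul_smul] at h
  rwa [pow_add, pow_add]

theorem colorMatrix_id (n : ℕ) : colorMatrix (id n) = 1 := by
  ext x y
  rw [colorMatrix, Matrix.one_apply]
  refine if_congr ⟨fun h => funext fun i => (h (Sum.inr i)), ?_⟩ rfl rfl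
  rintro rfl (i | i) <;> rfl

theorem colorMatrix_flip {n m : ℕ} (a : TLDiagram n m) :
    colorMatrix a.flip = (colorMatrix a).transpose := by
  ext x y
  rw [colorMatrix, Matrix.transpose_apply, colorMatrix]
  have hs : ∀ w : Fin n ⊕ Fin m, Sum.elim x y w.swap = Sum.elim y x w := by
    rintro (w | w) <;> rfl
  refine if_congr ⟨fun h w => ?_, fun h w => ?_⟩ rfl rfl
  · have := h w.swap
    simpa only [flip, Sum.swap_swap, hs] using this
  · have := h w.swap
    rw [← hs, ← hs, Sum.swap_swap] at this
    exact this

theorem colorMatrix_addStrand {n m : ℕ} (a : TLDiagram n m) (x : Fin (n + 1) → Bool)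
    (y : Fin (m + 1) → Bool) : colorMatrix a.addStrand x y =
      if x (Fin.last n) = y (Fin.last m) then
        colorMatrix a (Fin.init x : Fin n → Bool) (Fin.init y : Fin m → Bool) else 0 := by
  have hs : ∀ w : Fin n ⊕ Fin m, Sum.elim x y (Sum.map Fin.castSucc Fin.castSucc w) =
      Sum.elim (Fin.init x : Fin n → Bool) (Fin.init y : Fin m → Bool) w := by
    rintro (w | w) <;> rfl
  have hl : a.addStrand.partner (Sum.inl (Fin.last n)) = Sum.inr (Fin.last m) := by
    simp [addStrand, addStrandPartner]
  have hr : a.addStrand.partner (Sum.inr (Fin.last m)) = Sum.inl (Fin.last n) := by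
    simp [addStrand, addStrandPartner]
  rw [colorMatrix, colorMatrix, ← ite_and]
  refine if_congr ⟨fun h => ⟨?_, fun w => ?_⟩, fun h w => ?_⟩ rfl rfl
  · have := h (Sum.inr (Fin.last m))
    rwa [hr] at this
  · rw [← hs, ← hs, ← addStrandPartner_map]
    exact h _
  · rcases addStrand_cases w with ⟨w, rfl⟩ | rfl | rfl
    · have : a.addStrand.partner (Sum.map Fin.castSucc Fin.castSucc w) =
        Sum.map Fin.castSucc Fin.castSucc (a.partner w) := addStrandPartner_map a w
      rw [this, hs, hs]
      exact h.2 w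
    · rw [hl]
      exact h.1.symm
    · rw [hr]
      exact h.1

theorem colorMatrix_cupLast (n : ℕ) (x : Fin n → Bool) (y : Fin (n + 2) → Bool) :
    colorMatrix (cupLast n) x y =
      if x = (fun i => y i.castSucc.castSucc) ∧ y (Fin.last n).castSucc = y (Fin.last (n + 1))
      then 1 else 0 := by
  have h1 : ∀ i : Fin n, (cupLast n).partner (Sum.inl i) = Sum.inr i.castSucc.castSucc :=
    fun i => rfl
  have h2 : ∀ i : Fin n, (cupLast n).partner (Sum.inr i.castSucc.castSucc) = Sum.inl i := by
    intro i
    simp [cupLast]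
  have h3 : (cupLast n).partner (Sum.inr (Fin.last n).castSucc) = Sum.inr (Fin.last (n + 1)) := by
    simp [cupLast]
  have h4 : (cupLast n).partner (Sum.inr (Fin.last (n + 1))) = Sum.inr (Fin.last n).castSucc := by
    simp [cupLast]
  rw [colorMatrix]
  refine if_congr ⟨fun h => ⟨funext fun i => ?_, ?_⟩, fun h w => ?_⟩ rfl rfl
  · have := h (Sum.inr i.castSucc.castSucc)
    rwa [h2] at this
  · have := h (Sum.inr (Fin.last (n + 1)))
    rwa [h4] at this
  · rcases w with i | j
    · rw [h1]
      exact (congrFun h.1 i).symm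
    · induction j using Fin.lastCases with
      | last =>
        rw [h4]
        exact h.2
      | cast j =>
        induction j using Fin.lastCases with
        | last =>
          rw [h3]
          exact h.2.symm
        | cast j =>
          rw [h2]
          exact congrFun h.1 j

/-! ### Identities between composites of diagrams -/

theorem id_comp {n m : ℕ} (a : TLDiagram n m) : loops (id n) a = 0 ∧ comp (id n) a = a :=
  comp_eq_of_colorMatrix (by rw [colorMatrix_id, Matrix.one_mul, pow_zero, one_smul])

theorem comp_id {n m : ℕ} (a : TLDiagram n m) : loops a (id m) = 0 ∧ comp a (id m) = a :=
  comp_eq_of_colorMatrix (by rw [colorMatrix_id, Matrix.mul_one, pow_zero, one_smul])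

theorem flip_comp {n m l : ℕ} (a : TLDiagram n m) (b : TLDiagram m l) :
    loops b.flip a.flip = loops a b ∧ comp b.flip a.flip = (comp a b).flip :=
  comp_eq_of_colorMatrix (by
    rw [colorMatrix_flip, colorMatrix_flip, colorMatrix_flip, ← Matrix.transpose_mul,
      colorMatrix_mul, Matrix.transpose_smul])

theorem flip_flip {n m : ℕ} (a : TLDiagram n m) : a.flip.flip = a :=
  colorMatrix_injective _ _ (by rw [colorMatrix_flip, colorMatrix_flip, Matrix.transpose_transpose])

theorem flip_id (n : ℕ) : (id n).flip = id n :=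
  colorMatrix_injective _ _ (by rw [colorMatrix_flip, colorMatrix_id, Matrix.transpose_one])

theorem addStrand_flip {n m : ℕ} (a : TLDiagram n m) : a.addStrand.flip = a.flip.addStrand := by
  apply colorMatrix_injective
  ext x y
  rw [colorMatrix_flip, Matrix.transpose_apply, colorMatrix_addStrand, colorMatrix_addStrand,
    colorMatrix_flip, Matrix.transpose_apply]
  exact if_congr eq_comm rfl rfl

theorem sum_snoc_bool {n : ℕ} (f : (Fin (n + 1) → Bool) → ℕ) :
    ∑ y, f y = ∑ b : Bool, ∑ y : Fin n → Bool, f (Fin.snoc y b : Fin (n + 1) → Bool) := by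
  rw [← (Fin.snocEquiv fun _ : Fin (n + 1) => Bool).sum_comp, Fintype.sum_prod_type]
  rfl

theorem addStrand_comp {n m l : ℕ} (a : TLDiagram n m) (b : TLDiagram m l) :
    loops a.addStrand b.addStrand = loops a b ∧
      comp a.addStrand b.addStrand = (comp a b).addStrand := by
  apply comp_eq_of_colorMatrix
  ext x z
  have h := congrFun (congrFun (colorMatrix_mul a b) (Fin.init x : Fin n → Bool))
    (Fin.init z : Fin l → Bool)
  rw [Matrix.mul_apply] at h ⊢
  rw [Matrix.smul_apply] at h ⊢
  rw [sum_snoc_bool]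
  simp only [colorMatrix_addStrand, Fin.snoc_last, Fin.init_snoc]
  rcases hx : x (Fin.last n) <;> rcases hz : z (Fin.last l) <;> simp [h]

theorem addStrand_id (n : ℕ) : (id n).addStrand = id (n + 1) := by
  apply colorMatrix_injective
  ext x y
  rw [colorMatrix_addStrand, colorMatrix_id, colorMatrix_id, Matrix.one_apply, Matrix.one_apply,
    ← ite_and]
  refine if_congr ⟨fun h => ?_, ?_⟩ rfl rfl
  · rw [← Fin.snoc_init_self x, ← Fin.snoc_init_self y, h.1, h.2]
  · rintro rfl
    exact ⟨rfl, rfl⟩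

open Matrix in
theorem mul_transpose_colorMatrix_cupLast {ι : Type} {n : ℕ}
    (A : Matrix ι (Fin (n + 2) → Bool) ℕ) (u : ι) (v : Fin n → Bool) :
    (A * (colorMatrix (cupLast n))ᵀ) u v =
      ∑ b : Bool, A u (Fin.snoc (Fin.snoc v b : Fin (n + 1) → Bool) b : Fin (n + 2) → Bool) := by
  rw [Matrix.mul_apply, sum_snoc_bool]
  refine Finset.sum_congr rfl fun b _ => ?_
  rw [sum_snoc_bool, Finset.sum_eq_single b, Finset.sum_eq_single v]
  · rw [Matrix.transpose_apply, colorMatrix_cupLast, if_pos, mul_one]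
    refine ⟨funext fun i => ?_, ?_⟩
    · rw [Fin.snoc_castSucc, Fin.snoc_castSucc]
    · rw [Fin.snoc_castSucc, Fin.snoc_last, Fin.snoc_last]
  · intro w _ hw
    simp [colorMatrix_cupLast, hw.symm]
  · simp
  · intro b' _ hb
    simp [colorMatrix_cupLast, hb]
  · simp

theorem colorMatrix_cupLast_mul {ι : Type} {n : ℕ}
    (A : Matrix (Fin (n + 2) → Bool) ι ℕ) (u : ι) (v : Fin n → Bool) :
    (colorMatrix (cupLast n) * A) v u =
      ∑ b : Bool, A (Fin.snoc (Fin.snoc v b : Fin (n + 1) → Bool) b : Fin (n + 2) → Bool) u := by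
  rw [← Matrix.transpose_apply (_ * _), Matrix.transpose_mul, mul_transpose_colorMatrix_cupLast]
  rfl

theorem mul_colorMatrix_cupLast {ι : Type} {n : ℕ} (A : Matrix ι (Fin n → Bool) ℕ) (u : ι)
    (w : Fin (n + 2) → Bool) : (A * colorMatrix (cupLast n)) u w =
      if w (Fin.last n).castSucc = w (Fin.last (n + 1)) then
        A u (fun i => w i.castSucc.castSucc) else 0 := by
  rw [Matrix.mul_apply]
  simp only [colorMatrix_cupLast, ite_and, mul_ite, mul_one, mul_zero]
  rw [Finset.sum_ite_eq' Finset.univ]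
  simp

theorem cupLast_comp_flip (n : ℕ) :
    loops (cupLast n) (cupLast n).flip = 1 ∧ comp (cupLast n) (cupLast n).flip = id n := by
  apply comp_eq_of_colorMatrix
  ext u v
  rw [colorMatrix_flip, mul_transpose_colorMatrix_cupLast, colorMatrix_id, Matrix.smul_apply,
    Matrix.one_apply]
  simp [colorMatrix_cupLast]

theorem cupLast_zigzag (n : ℕ) :
    loops (cupLast n).addStrand (cupLast (n + 1)).flip = 0 ∧
      comp (cupLast n).addStrand (cupLast (n + 1)).flip = id (n + 1) := by
  apply comp_eq_of_colorMatrix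
  ext u v
  rw [colorMatrix_flip, mul_transpose_colorMatrix_cupLast, colorMatrix_id, Matrix.smul_apply,
    Matrix.one_apply]
  simp only [colorMatrix_addStrand, Fin.snoc_last, Fin.init_snoc, colorMatrix_cupLast, pow_zero,
    one_smul]
  rw [Finset.sum_ite_eq]
  have : u = v ↔ ((Fin.init u : Fin n → Bool) =
      fun i => (Fin.snoc v (u (Fin.last n)) : Fin (n + 2) → Bool) i.castSucc.castSucc) ∧
      (Fin.snoc v (u (Fin.last n)) : Fin (n + 2) → Bool) (Fin.last n).castSucc =
        (Fin.snoc v (u (Fin.last n)) : Fin (n + 2) → Bool) (Fin.last (n + 1)) := by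
    simp only [Fin.snoc_castSucc, Fin.snoc_last]
    constructor
    · rintro rfl
      exact ⟨rfl, rfl⟩
    · rintro ⟨h1, h2⟩
      rw [← Fin.snoc_init_self u, ← Fin.snoc_init_self v, h2, h1]
      rfl
  simp [this]

/-- The interchange law for a diagram and a cup to its right. No circle arises on either side, since
the matrix product has entry `1` at the constant colouring. -/
theorem comp_cupLast {n m : ℕ} (a : TLDiagram n m) :
    loops a (cupLast m) = 0 ∧ loops (cupLast n) a.addStrand.addStrand = 0 ∧
      comp a (cupLast m) = comp (cupLast n) a.addStrand.addStrand := by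
  have e1 : colorMatrix a * colorMatrix (cupLast m) =
      colorMatrix (cupLast n) * colorMatrix a.addStrand.addStrand := by
    ext u w
    rw [mul_colorMatrix_cupLast, colorMatrix_cupLast_mul]
    simp only [colorMatrix_addStrand, Fin.snoc_last, Fin.init_snoc]
    rw [Finset.sum_ite_eq']
    simp only [Finset.mem_univ, if_true]
    exact if_congr eq_comm rfl rfl
  have e3 := congrFun (congrFun (colorMatrix_mul a (cupLast m)) fun _ => true) fun _ => true
  rw [mul_colorMatrix_cupLast, if_pos rfl, colorMatrix_const, Matrix.smul_apply,
    colorMatrix_const, smul_eq_mul, mul_one] at e3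
  have e4 : loops a (cupLast m) = 0 := by
    by_contra h
    exact absurd e3.symm (Nat.one_lt_two_pow h).ne'
  have e5 := pow_smul_colorMatrix_inj
    ((colorMatrix_mul _ _).symm.trans (e1.trans (colorMatrix_mul _ _)))
  exact ⟨e4, e5.1.symm.trans e4, e5.2⟩

/-! ### Elementary diagrams and neighbouring cups -/

/-- The elementary diagram `e` multiplies by `2` the functions of colourings that are induced from
colourings of the points other than `j` and `j + 1`. -/
def IsElementary {n : ℕ} (e : TLDiagram n n) (j : ℕ) : Prop :=
  ∀ f : (Fin n → Bool) → ℕ,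
    (∀ y, (∃ i i' : Fin n, (i : ℕ) = j ∧ (i' : ℕ) = j + 1 ∧ y i ≠ y i') → f y = 0) →
    (∀ y y', (∀ i i' : Fin n, (i : ℕ) = j → (i' : ℕ) = j + 1 → y i = y i' ∧ y' i = y' i') →
      (∀ i : Fin n, (i : ℕ) ≠ j → (i : ℕ) ≠ j + 1 → y i = y' i) → f y = f y') →
    ∀ y', ∑ y, f y * colorMatrix e y y' = 2 * f y'

theorem isElementary_cupLast (n : ℕ) :
    IsElementary (comp (cupLast n).flip (cupLast n)) n := by
  intro f h0 h1 y'
  have hl : loops (cupLast n).flip (cupLast n) = 0 := (comp_cupLast _).1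
  have e := colorMatrix_mul (cupLast n).flip (cupLast n)
  rw [hl, pow_zero, one_smul] at e
  rw [← e, colorMatrix_flip]
  have h2 : ∑ y, f y * ((colorMatrix (cupLast n)).transpose * colorMatrix (cupLast n)) y y' =
      ((Matrix.of fun (_ : Unit) y => f y) * (colorMatrix (cupLast n)).transpose *
        colorMatrix (cupLast n)) () y' := by
    rw [Matrix.mul_assoc, Matrix.mul_apply]
    rfl
  rw [h2, mul_colorMatrix_cupLast, mul_transpose_colorMatrix_cupLast]
  simp only [Matrix.of_apply]
  split_ifs with h
  -- The cap sums over the common colour of the last two points, on which `f` does not depend: two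
  -- equal terms.
  · have h3 : ∀ b, f (Fin.snoc (Fin.snoc (fun i : Fin n => y' i.castSucc.castSucc) b :
        Fin (n + 1) → Bool) b : Fin (n + 2) → Bool) = f y' := by
      intro b
      apply h1
      · intro i i' hi hi'
        have hi : i = (Fin.last n).castSucc := Fin.ext hi
        have hi' : i' = Fin.last (n + 1) := Fin.ext hi'
        subst hi hi'
        refine ⟨?_, h⟩
        rw [Fin.snoc_castSucc, Fin.snoc_last, Fin.snoc_last]
      · intro i hi hi'
        obtain ⟨k, rfl⟩ : ∃ k : Fin n, k.castSucc.castSucc = i :=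
          ⟨⟨i, by omega⟩, rfl⟩
        rw [Fin.snoc_castSucc, Fin.snoc_castSucc]
    simp only [h3]
    simp [two_mul]
  · rw [h0, mul_zero]
    exact ⟨(Fin.last n).castSucc, Fin.last (n + 1), rfl, rfl, h⟩

theorem IsElementary.addStrand {n j : ℕ} {e : TLDiagram n n} (he : IsElementary e j)
    (hj : j + 1 < n) : IsElementary e.addStrand j := by
  intro f h0 h1 y'
  rw [sum_snoc_bool]
  simp only [colorMatrix_addStrand, Fin.snoc_last, Fin.init_snoc]
  simp only [mul_ite, mul_zero]
  rw [Finset.sum_comm]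
  simp only [Finset.sum_ite_eq', Finset.mem_univ, if_true]
  rw [he (fun y => f (Fin.snoc y (y' (Fin.last n)) : Fin (n + 1) → Bool)) _ _ (Fin.init y'),
    Fin.snoc_init_self]
  · rintro y ⟨i, i', hi, hi', hy⟩
    exact h0 _ ⟨i.castSucc, i'.castSucc, hi, hi', by simpa using hy⟩
  · intro y z h2 h3
    apply h1
    · intro i i' hi hi'
      obtain ⟨k, rfl⟩ : ∃ k : Fin n, k.castSucc = i := ⟨⟨i, by omega⟩, rfl⟩
      obtain ⟨k', rfl⟩ : ∃ k : Fin n, k.castSucc = i' := ⟨⟨i', by omega⟩, rfl⟩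
      simpa using h2 k k' hi hi'
    · intro i hi hi'
      induction i using Fin.lastCases with
      | last => simp
      | cast i => simpa using h3 i hi hi'

/-- For fixed bottom colours, the entry of `c` vanishes unless the two neighbours agree, and then it
does not depend on their common colour. So `e` doubles the matrix of `c`: one circle splits off and
`c` remains. -/
theorem IsElementary.comp_eq {n l j : ℕ} {e : TLDiagram n n} (he : IsElementary e j)
    (c : TLDiagram l n) (i i' : Fin n) (hi : (i : ℕ) = j) (hi' : (i' : ℕ) = j + 1)
    (hc : c.partner (Sum.inr i) = Sum.inr i') : loops c e = 1 ∧ comp c e = c := by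
  have hc' : c.partner (Sum.inr i') = Sum.inr i := by rw [← hc, c.partner_partner]
  apply comp_eq_of_colorMatrix
  ext x y'
  rw [Matrix.mul_apply, he, Matrix.smul_apply, pow_one, smul_eq_mul]
  · rintro y ⟨k, k', hk, hk', hy⟩
    have hk : k = i := Fin.ext (hk.trans hi.symm)
    have hk' : k' = i' := Fin.ext (hk'.trans hi'.symm)
    subst hk hk'
    rw [colorMatrix, if_neg]
    intro h
    have := h (Sum.inr k)
    rw [hc] at this
    exact hy this.symm
  · intro y z h2 h3
    obtain ⟨hy, hz⟩ := h2 i i' hi hi'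
    rw [colorMatrix, colorMatrix]
    have h4 : ∀ w, w ≠ Sum.inr i → w ≠ Sum.inr i' → Sum.elim x y w = Sum.elim x z w := by
      rintro (w | w) h5 h6
      · rfl
      · refine h3 w (fun h => h5 ?_) fun h => h6 ?_
        · rw [Fin.ext (h.trans hi.symm)]
        · rw [Fin.ext (h.trans hi'.symm)]
    refine if_congr (forall_congr' fun w => ?_) rfl rfl
    by_cases w1 : w = Sum.inr i
    · rw [w1, hc]
      simp [hy, hz]
    · by_cases w2 : w = Sum.inr i'
      · rw [w2, hc']
        simp [hy, hz]
      · rw [h4 w w1 w2, h4 (c.partner w)]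
        · intro h
          exact w2 (by rw [← c.partner_partner w, h, hc])
        · intro h
          exact w1 (by rw [← c.partner_partner w, h, hc'])

/-- A diagram with fewer points at the bottom than at the top has a chord that joins two adjacent
points of the top. -/
theorem exists_adjacent_cup {n m : ℕ} (c : TLDiagram n m) (h : n < m) :
    ∃ i i' : Fin m, (i' : ℕ) = i + 1 ∧ c.partner (Sum.inr i) = Sum.inr i' := by
  have h1 : ∃ i i' : Fin m, c.partner (Sum.inr i) = Sum.inr i' := by
    by_contra hn
    push Not at hn
    have : ∀ i, ∃ j, c.partner (Sum.inr i) = Sum.inl j := by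
      intro i
      rcases e : c.partner (Sum.inr i) with j | j
      · exact ⟨j, rfl⟩
      · exact absurd e (hn i j)
    choose f hf using this
    -- If no chord joined two top points, all top points would be matched injectively with bottom
    -- points.
    have hinj : Function.Injective f := by
      intro i j hij
      have := (hf i).trans ((congrArg Sum.inl hij).trans (hf j).symm)
      have := congrArg c.partner this
      rw [c.partner_partner, c.partner_partner] at this
      exact Sum.inr_injective this
    have := Fintype.card_le_of_injective f hinj
    simp only [Fintype.card_fin] at this
    omega
  have h2 : ∃ d : ℕ, ∃ i i' : Fin m, (i' : ℕ) = i + d ∧ c.partner (Sum.inr i) = Sum.inr i' := by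
    obtain ⟨i, i', e⟩ := h1
    rcases le_total i i' with hle | hle
    · exact ⟨i' - i, i, i', by have : (i : ℕ) ≤ i' := hle; omega, e⟩
    · exact ⟨i - i', i', i, by have : (i' : ℕ) ≤ i := hle; omega, by rw [← e, c.partner_partner]⟩
  classical
  -- A chord of minimal span among those joining two top points. If the span exceeded `1`, the point
  -- `k = i + 1` below it would, by planarity, be matched inside the interval, by a chord of smaller
  -- span.
  obtain ⟨i, i', hd, e⟩ := Nat.find_spec h2
  have hmin := fun d hd => Nat.find_min h2 (m := d) hd
  generalize Nat.find h2 = d at hd hmin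
  have e' : c.partner (Sum.inr i') = Sum.inr i := by rw [← e, c.partner_partner]
  have hd0 : d ≠ 0 := by
    rintro rfl
    have : i' = i := Fin.ext hd
    rw [this] at e
    exact c.partner_ne _ e
  by_cases hd1 : d = 1
  · exact ⟨i, i', by omega, e⟩
  exfalso
  have hi := i'.2
  obtain ⟨k, hk⟩ : ∃ k : Fin m, (k : ℕ) = i + 1 := ⟨⟨i + 1, by omega⟩, rfl⟩
  have n1 := c.noncrossing (Sum.inr i') (Sum.inr k)
  have n2 := c.noncrossing (c.partner (Sum.inr k)) (Sum.inr i')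
  rw [c.partner_partner] at n2
  rw [e'] at n1 n2
  rcases hp : c.partner (Sum.inr k) with j | j
  · rw [hp] at n2
    simp only [boundaryPos, Fin.val_rev] at n2
    omega
  · rw [hp] at n1 n2
    simp only [boundaryPos, Fin.val_rev] at n1 n2
    have hj1 : (j : ℕ) ≠ i := by
      intro h
      rw [Fin.ext h, ← e'] at hp
      have := congrArg c.partner hp
      rw [c.partner_partner, c.partner_partner] at this
      have := Fin.val_eq_of_eq (Sum.inr_injective this)
      omega
    have hj2 : (j : ℕ) ≠ i' := by
      intro h
      rw [Fin.ext h, ← e] at hp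
      have := congrArg c.partner hp
      rw [c.partner_partner, c.partner_partner] at this
      have := Fin.val_eq_of_eq (Sum.inr_injective this)
      omega
    have hj3 : (j : ℕ) ≠ k := by
      intro h
      rw [Fin.ext h] at hp
      exact c.partner_ne _ hp
    have := j.2
    have hj4 : (k : ℕ) < j ∧ (j : ℕ) < i' := by omega
    exact hmin (j - k) (by omega) ⟨k, j, by omega, hp⟩

/-- The identity diagram does not factor through fewer points. -/
theorem comp_ne_id {n m : ℕ} (a : TLDiagram n m) (b : TLDiagram m n) (h : m < n) :
    comp a b ≠ id n := by
  intro hab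
  -- A chord of `b` between two top points survives in the composite, whereas the identity has no
  -- such chord.
  obtain ⟨i, i', hi, e⟩ := exists_adjacent_cup b h
  have h1 : (comp a b).partner (Sum.inr i) = Sum.inr i' := by
    rw [comp_partner_eq_iff]
    refine ⟨fun h => ?_, ?_⟩
    · have := Fin.val_eq_of_eq (Sum.inr_injective h)
      omega
    · have := reachable_sumMap a b (Sum.inr (Sum.inr i))
      simp only [Sum.map_inr, e] at this
      exact this
  rw [hab] at h1
  simp [id] at h1

end TLDiagram

/-! ### The linear category: bilinearity, reflection, adjoining a strand -/

namespace TL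

theorem comp_add {n m l : ℕ} (b : TL m l) (a a' : TL n m) :
    comp b (a + a') = comp b a + comp b a' := by
  unfold comp
  rw [← Finsupp.sum_add]
  refine Finsupp.sum_congr fun E _ => ?_
  rw [Finsupp.sum_add_index']
  · simp
  · intro D x y
    rw [mul_add, add_mul, add_smul]

theorem add_comp {n m l : ℕ} (b b' : TL m l) (a : TL n m) :
    comp (b + b') a = comp b a + comp b' a := by
  unfold comp
  rw [Finsupp.sum_add_index']
  · simp
  · intro E y y'
    rw [← Finsupp.sum_add]
    refine Finsupp.sum_congr fun D _ => ?_
    rw [add_mul, add_mul, add_smul]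

theorem comp_smul {n m l : ℕ} (b : TL m l) (r : RatFunc ℂ) (a : TL n m) :
    comp b (r • a) = r • comp b a := by
  unfold comp
  rw [Finsupp.smul_sum]
  refine Finsupp.sum_congr fun E _ => ?_
  rw [Finsupp.sum_smul_index (by simp), Finsupp.smul_sum]
  refine Finsupp.sum_congr fun D _ => ?_
  rw [smul_smul]
  congr 1
  ring

theorem smul_comp {n m l : ℕ} (b : TL m l) (r : RatFunc ℂ) (a : TL n m) :
    comp (r • b) a = r • comp b a := by
  unfold comp
  rw [Finsupp.sum_smul_index (by simp), Finsupp.smul_sum]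
  refine Finsupp.sum_congr fun E _ => ?_
  rw [Finsupp.smul_sum]
  refine Finsupp.sum_congr fun D _ => ?_
  rw [smul_smul]
  congr 1
  ring

/-- Composition as a bilinear map. -/
noncomputable def compHom (n m l : ℕ) : TL m l →ₗ[RatFunc ℂ] TL n m →ₗ[RatFunc ℂ] TL n l :=
  LinearMap.mk₂ _ comp add_comp (fun r b a => smul_comp b r a) comp_add
    (fun r b a => comp_smul b r a)

theorem comp_zero {n m l : ℕ} (b : TL m l) : comp b (0 : TL n m) = 0 :=
  (compHom n m l b).map_zero

theorem zero_comp {n m l : ℕ} (a : TL n m) : comp (0 : TL m l) a = 0 :=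
  (compHom n m l).map_zero₂ a

theorem comp_sub {n m l : ℕ} (b : TL m l) (a a' : TL n m) :
    comp b (a - a') = comp b a - comp b a' :=
  (compHom n m l b).map_sub a a'

theorem sub_comp {n m l : ℕ} (b b' : TL m l) (a : TL n m) :
    comp (b - b') a = comp b a - comp b' a :=
  (compHom n m l).map_sub₂ b b' a

theorem comp_sum {n m l : ℕ} {ι : Type} (b : TL m l) (s : Finset ι) (f : ι → TL n m) :
    comp b (∑ i ∈ s, f i) = ∑ i ∈ s, comp b (f i) :=
  map_sum (compHom n m l b) f s

theorem sum_comp {n m l : ℕ} {ι : Type} (s : Finset ι) (f : ι → TL m l) (a : TL n m) :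
    comp (∑ i ∈ s, f i) a = ∑ i ∈ s, comp (f i) a :=
  LinearMap.map_sum₂ (compHom n m l) s f a

theorem comp_ofDiagram {n m l : ℕ} (E : TLDiagram m l) (D : TLDiagram n m) :
    comp (ofDiagram E) (ofDiagram D) =
      (qVar + qVar⁻¹) ^ TLDiagram.loops D E • ofDiagram (TLDiagram.comp D E) := by
  unfold comp
  rw [ofDiagram, ofDiagram, Finsupp.sum_single_index, Finsupp.sum_single_index] <;> simp

theorem induction_linear {n m : ℕ} {P : TL n m → Prop} (a : TL n m) (h0 : P 0)
    (hadd : ∀ a b, P a → P b → P (a + b))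
    (hsmul : ∀ (r : RatFunc ℂ) (D : TLDiagram n m), P (r • ofDiagram D)) : P a := by
  induction a using Finsupp.induction_linear with
  | zero => exact h0
  | add a b ha hb => exact hadd a b ha hb
  | single D r =>
    have := hsmul r D
    rwa [ofDiagram, Finsupp.smul_single, smul_eq_mul, mul_one] at this

theorem comp_assoc {n m l k : ℕ} (c : TL l k) (b : TL m l) (a : TL n m) :
    comp (comp c b) a = comp c (comp b a) := by
  induction a using induction_linear with
  | h0 => simp only [comp_zero]
  | hadd a a' h h' => simp only [comp_add, h, h']
  | hsmul r D =>
    simp only [comp_smul]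
    congr 1
    induction b using induction_linear with
    | h0 => simp only [comp_zero, zero_comp]
    | hadd a a' h h' => simp only [comp_add, add_comp, h, h']
    | hsmul r E =>
      simp only [comp_smul, smul_comp]
      congr 1
      induction c using induction_linear with
      | h0 => simp only [zero_comp]
      | hadd a a' h h' => simp only [add_comp, h, h']
      | hsmul r F =>
        simp only [smul_comp]
        congr 1
        obtain ⟨h1, h2⟩ := TLDiagram.comp_assoc D E F
        rw [comp_ofDiagram, comp_ofDiagram, comp_smul, smul_comp, comp_ofDiagram, comp_ofDiagram,
          smul_smul, smul_smul, ← pow_add, ← pow_add, h1, h2]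

theorem one_comp {n m : ℕ} (a : TL n m) : comp (one m) a = a := by
  induction a using induction_linear with
  | h0 => simp only [comp_zero]
  | hadd a a' h h' => simp only [comp_add, h, h']
  | hsmul r D =>
    obtain ⟨h1, h2⟩ := TLDiagram.comp_id D
    rw [comp_smul, one, comp_ofDiagram, h1, h2, pow_zero, one_smul]

theorem comp_one {n m : ℕ} (a : TL n m) : comp a (one n) = a := by
  induction a using induction_linear with
  | h0 => simp only [zero_comp]
  | hadd a a' h h' => simp only [add_comp, h, h']
  | hsmul r D =>
    obtain ⟨h1, h2⟩ := TLDiagram.id_comp D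
    rw [smul_comp, one, comp_ofDiagram, h1, h2, pow_zero, one_smul]

theorem bar_zero {n m : ℕ} : bar (0 : TL n m) = 0 := Finsupp.mapDomain_zero

theorem bar_add {n m : ℕ} (a b : TL n m) : bar (a + b) = bar a + bar b := Finsupp.mapDomain_add

theorem bar_smul {n m : ℕ} (r : RatFunc ℂ) (a : TL n m) : bar (r • a) = r • bar a :=
  Finsupp.mapDomain_smul r a

theorem bar_sub {n m : ℕ} (a b : TL n m) : bar (a - b) = bar a - bar b := by
  rw [sub_eq_add_neg, ← neg_one_smul (RatFunc ℂ), bar_add, bar_smul, neg_one_smul, sub_eq_add_neg]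

theorem bar_ofDiagram {n m : ℕ} (D : TLDiagram n m) : bar (ofDiagram D) = ofDiagram D.flip :=
  Finsupp.mapDomain_single

theorem bar_bar {n m : ℕ} (a : TL n m) : bar (bar a) = a := by
  induction a using induction_linear with
  | h0 => simp only [bar_zero]
  | hadd a a' h h' => simp only [bar_add, h, h']
  | hsmul r D => rw [bar_smul, bar_smul, bar_ofDiagram, bar_ofDiagram, TLDiagram.flip_flip]

theorem bar_comp {n m l : ℕ} (b : TL m l) (a : TL n m) :
    bar (comp b a) = comp (bar a) (bar b) := by
  induction a using induction_linear with
  | h0 => simp only [comp_zero, zero_comp, bar_zero]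
  | hadd a a' h h' => simp only [comp_add, add_comp, bar_add, h, h']
  | hsmul r D =>
    simp only [comp_smul, bar_smul, smul_comp]
    congr 1
    induction b using induction_linear with
    | h0 => simp only [comp_zero, zero_comp, bar_zero]
    | hadd a a' h h' => simp only [comp_add, add_comp, bar_add, h, h']
    | hsmul r E =>
      obtain ⟨h1, h2⟩ := TLDiagram.flip_comp D E
      simp only [comp_smul, bar_smul, smul_comp, comp_ofDiagram, bar_ofDiagram, h1, h2]

theorem bar_one (n : ℕ) : bar (one n) = one n := by
  rw [one, bar_ofDiagram, TLDiagram.flip_id]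

theorem addStrand_zero {n m : ℕ} : addStrand (0 : TL n m) = 0 := Finsupp.mapDomain_zero

theorem addStrand_add {n m : ℕ} (a b : TL n m) :
    addStrand (a + b) = addStrand a + addStrand b := Finsupp.mapDomain_add

theorem addStrand_smul {n m : ℕ} (r : RatFunc ℂ) (a : TL n m) :
    addStrand (r • a) = r • addStrand a :=
  Finsupp.mapDomain_smul r a

theorem addStrand_sub {n m : ℕ} (a b : TL n m) :
    addStrand (a - b) = addStrand a - addStrand b := by
  rw [sub_eq_add_neg, ← neg_one_smul (RatFunc ℂ), addStrand_add, addStrand_smul, neg_one_smul,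
    sub_eq_add_neg]

theorem addStrand_ofDiagram {n m : ℕ} (D : TLDiagram n m) :
    addStrand (ofDiagram D) = ofDiagram D.addStrand :=
  Finsupp.mapDomain_single

theorem addStrand_sum {n m : ℕ} {ι : Type} (s : Finset ι) (f : ι → TL n m) :
    addStrand (∑ i ∈ s, f i) = ∑ i ∈ s, addStrand (f i) :=
  Finsupp.mapDomain_finsetSum

theorem addStrand_one (n : ℕ) : addStrand (one n) = one (n + 1) := by
  rw [one, addStrand_ofDiagram, TLDiagram.addStrand_id, one]

theorem addStrand_comp {n m l : ℕ} (b : TL m l) (a : TL n m) :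
    addStrand (comp b a) = comp (addStrand b) (addStrand a) := by
  induction a using induction_linear with
  | h0 => simp only [comp_zero, addStrand_zero]
  | hadd a a' h h' => simp only [comp_add, addStrand_add, h, h']
  | hsmul r D =>
    simp only [comp_smul, addStrand_smul]
    congr 1
    induction b using induction_linear with
    | h0 => simp only [zero_comp, addStrand_zero]
    | hadd a a' h h' => simp only [add_comp, addStrand_add, h, h']
    | hsmul r E =>
      obtain ⟨h1, h2⟩ := TLDiagram.addStrand_comp D E
      simp only [addStrand_smul, smul_comp, comp_ofDiagram, addStrand_ofDiagram, h1, h2]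

theorem bar_addStrand {n m : ℕ} (a : TL n m) : bar (addStrand a) = addStrand (bar a) := by
  induction a using induction_linear with
  | h0 => simp only [bar_zero, addStrand_zero]
  | hadd a a' h h' => simp only [bar_add, addStrand_add, h, h']
  | hsmul r D =>
    simp only [addStrand_smul, bar_smul, addStrand_ofDiagram, bar_ofDiagram,
      TLDiagram.addStrand_flip]

theorem cupLast_comp {n m : ℕ} (a : TL n m) :
    comp (cupLast m) a = comp (addStrand (addStrand a)) (cupLast n) := by
  induction a using induction_linear with
  | h0 => simp only [comp_zero, zero_comp, addStrand_zero]
  | hadd a a' h h' => simp only [comp_add, add_comp, addStrand_add, h, h']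
  | hsmul r D =>
    obtain ⟨h1, h2, h3⟩ := TLDiagram.comp_cupLast D
    simp only [comp_smul, addStrand_smul, smul_comp, cupLast, comp_ofDiagram, addStrand_ofDiagram,
      h1, h2, h3]

theorem bar_cupLast_comp {n m : ℕ} (a : TL n m) :
    comp (bar (cupLast m)) (addStrand (addStrand a)) = comp a (bar (cupLast n)) := by
  have h := congrArg bar (cupLast_comp (bar a))
  rw [bar_comp, bar_comp, bar_addStrand, bar_addStrand, bar_bar] at h
  exact h.symm

theorem cap_comp_cup (n : ℕ) :
    comp (bar (cupLast n)) (cupLast n) = (qVar + qVar⁻¹) • one n := by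
  obtain ⟨h1, h2⟩ := TLDiagram.cupLast_comp_flip n
  rw [cupLast, bar_ofDiagram, comp_ofDiagram, h1, h2, pow_one, one]

theorem zigzag (n : ℕ) :
    comp (bar (cupLast (n + 1))) (addStrand (cupLast n)) = one (n + 1) := by
  obtain ⟨h1, h2⟩ := TLDiagram.cupLast_zigzag n
  rw [cupLast, cupLast, bar_ofDiagram, addStrand_ofDiagram, comp_ofDiagram, h1, h2, pow_zero,
    one_smul, one]

theorem zigzag' (n : ℕ) :
    comp (addStrand (bar (cupLast n))) (cupLast (n + 1)) = one (n + 1) := by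
  have h := congrArg bar (zigzag n)
  rwa [bar_comp, bar_bar, bar_addStrand, bar_one] at h

theorem bar_eLast (n : ℕ) : bar (eLast n) = eLast n := by
  rw [eLast, bar_comp, bar_bar]

/-! ### Quantum integers -/

theorem qVar_ne_zero : qVar ≠ 0 := RatFunc.X_ne_zero

theorem qVar_pow_ne_one {n : ℕ} (hn : n ≠ 0) : qVar ^ n ≠ 1 := by
  intro h
  have h1 : algebraMap (Polynomial ℂ) (RatFunc ℂ) (Polynomial.X ^ n) =
      algebraMap (Polynomial ℂ) (RatFunc ℂ) 1 := by
    rw [map_pow, map_one, RatFunc.algebraMap_X]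
    exact h
  have h2 := congrArg Polynomial.natDegree (RatFunc.algebraMap_injective ℂ h1)
  rw [Polynomial.natDegree_X_pow, Polynomial.natDegree_one] at h2
  exact hn h2

theorem qVar_sub_inv_ne_zero : qVar - qVar⁻¹ ≠ 0 := by
  intro h
  apply qVar_pow_ne_one two_ne_zero
  rw [sub_eq_zero] at h
  rw [pow_two]
  nth_rw 1 [h]
  exact inv_mul_cancel₀ qVar_ne_zero

theorem quantumInt_ne_zero {n : ℕ} (hn : n ≠ 0) : quantumInt n ≠ 0 := by
  refine div_ne_zero ?_ qVar_sub_inv_ne_zero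
  intro h
  rw [sub_eq_zero, zpow_neg, zpow_natCast] at h
  apply qVar_pow_ne_one (n := n + n) (by omega)
  rw [pow_add]
  nth_rw 1 [h]
  exact inv_mul_cancel₀ (pow_ne_zero n qVar_ne_zero)

/-- The loop value is `[2]`; this recurrence drives the partial trace of the Jones–Wenzl projectors.
-/
theorem delta_mul_quantumInt (k : ℤ) :
    (qVar + qVar⁻¹) * quantumInt (k + 1) = quantumInt (k + 2) + quantumInt k := by
  have h := qVar_sub_inv_ne_zero
  have h' := qVar_ne_zero
  unfold quantumInt
  rw [← add_div, ← mul_div_assoc]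
  congr 1
  have e1 : qVar ^ (k + 1) = qVar ^ k * qVar := zpow_add_one₀ h' k
  have e2 : qVar ^ (k + 2) = qVar ^ k * qVar * qVar := by
    rw [← e1, ← zpow_add_one₀ h', add_assoc]
    rfl
  rw [zpow_neg, zpow_neg, zpow_neg, e1, e2]
  have h'' : qVar ^ k ≠ 0 := zpow_ne_zero k h'
  field_simp
  ring

theorem quantumInt_zero : quantumInt 0 = 0 := by simp [quantumInt]

theorem quantumInt_one : quantumInt 1 = 1 := by
  rw [quantumInt, zpow_one, zpow_neg_one, div_self qVar_sub_inv_ne_zero]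

theorem delta_ne_zero : qVar + qVar⁻¹ ≠ 0 := by
  have h := delta_mul_quantumInt 0
  rw [zero_add, zero_add, quantumInt_one, quantumInt_zero, mul_one, add_zero] at h
  rw [h]
  exact quantumInt_ne_zero (n := 2) two_ne_zero

/-! ### Jones–Wenzl projectors -/

theorem jonesWenzl_succ_succ (n : ℕ) : jonesWenzl (n + 2) = addStrand (jonesWenzl (n + 1)) -
      (quantumInt (n + 1) / quantumInt (n + 2)) •
        comp (addStrand (jonesWenzl (n + 1))) (comp (eLast n) (addStrand (jonesWenzl (n + 1)))) := by
  rw [jonesWenzl]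

theorem bar_jonesWenzl (n : ℕ) : bar (jonesWenzl n) = jonesWenzl n := by
  induction n with
  | zero => exact bar_one 0
  | succ n ih =>
    cases n with
    | zero => exact bar_one 1
    | succ n =>
      rw [jonesWenzl_succ_succ, bar_sub, bar_smul, bar_comp, bar_comp, bar_eLast, bar_addStrand, ih,
        comp_assoc]

/-- If `p_{n+1}` absorbs `p_n` and has the expected partial trace, then `p_{n+2}` kills the last
cup. -/
theorem jonesWenzl_comp_cupLast_of {n : ℕ}
    (h : comp (jonesWenzl (n + 1)) (addStrand (jonesWenzl n)) = jonesWenzl (n + 1))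
    (ht : comp (bar (cupLast n)) (comp (addStrand (jonesWenzl (n + 1))) (cupLast n)) =
      (quantumInt (n + 2) / quantumInt (n + 1)) • jonesWenzl n) :
    comp (jonesWenzl (n + 2)) (cupLast n) = 0 := by
  have h1 : quantumInt ((n : ℤ) + 1) ≠ 0 := quantumInt_ne_zero (n := n + 1) (by omega)
  have h2 : quantumInt ((n : ℤ) + 2) ≠ 0 := quantumInt_ne_zero (n := n + 2) (by omega)
  -- The partial trace produces `[n+2]/[n+1]`, which cancels the coefficient of Wenzl's recurrence;
  -- absorbing `p_n ⊔ 1` then makes the two terms equal.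
  rw [jonesWenzl_succ_succ, sub_comp, smul_comp, eLast, comp_assoc, comp_assoc, comp_assoc, ht,
    comp_smul, cupLast_comp, comp_smul, ← comp_assoc, ← addStrand_comp, h, smul_smul,
    div_mul_div_cancel₀ h2, div_self h1, one_smul, sub_self]

/-- Idempotence, absorption and partial trace need each other, so they go through one induction.
Absorption and trace at one stage make the next projector kill the last cup, which yields its
idempotence. -/
theorem jonesWenzl_aux (n : ℕ) :
    comp (jonesWenzl (n + 1)) (jonesWenzl (n + 1)) = jonesWenzl (n + 1) ∧
    comp (jonesWenzl (n + 1)) (addStrand (jonesWenzl n)) = jonesWenzl (n + 1) ∧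
    comp (bar (cupLast n)) (comp (addStrand (jonesWenzl (n + 1))) (cupLast n)) =
      (quantumInt (n + 2) / quantumInt (n + 1)) • jonesWenzl n := by
  induction n with
  | zero =>
    have h := delta_mul_quantumInt 0
    rw [zero_add, zero_add, quantumInt_one, quantumInt_zero, mul_one, add_zero] at h
    refine ⟨one_comp _, ?_, ?_⟩
    · rw [jonesWenzl, jonesWenzl, addStrand_one, one_comp]
    · rw [jonesWenzl, jonesWenzl, addStrand_one, one_comp, cap_comp_cup, h, Nat.cast_zero,
        zero_add, zero_add, quantumInt_one, div_one]
  | succ n ih =>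
    obtain ⟨h1, h2, h3⟩ := ih
    have hA : comp (addStrand (jonesWenzl (n + 1))) (addStrand (jonesWenzl (n + 1))) =
        addStrand (jonesWenzl (n + 1)) := by rw [← addStrand_comp, h1]
    have hc := jonesWenzl_comp_cupLast_of h2 h3
    have hp : comp (jonesWenzl (n + 2)) (addStrand (jonesWenzl (n + 1))) = jonesWenzl (n + 2) := by
      rw [jonesWenzl_succ_succ, sub_comp, smul_comp, comp_assoc, comp_assoc, hA]
    refine ⟨?_, hp, ?_⟩
    · nth_rw 2 [jonesWenzl_succ_succ]
      rw [comp_sub, comp_smul, hp, ← comp_assoc (jonesWenzl (n + 2)), hp, eLast, comp_assoc,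
        ← comp_assoc (jonesWenzl (n + 2)), hc, zero_comp, smul_zero, sub_zero]
    -- Closing the last strand of the recurrence: the first term acquires a circle, and the second
    -- straightens by two zigzags. The trace is therefore `[2] - [n+1]/[n+2] = [n+3]/[n+2]` times
    -- `p_{n+1}`.
    · have e1 : comp (bar (cupLast (n + 1)))
          (comp (addStrand (addStrand (jonesWenzl (n + 1)))) (cupLast (n + 1))) =
          (qVar + qVar⁻¹) • jonesWenzl (n + 1) := by
        rw [← cupLast_comp, ← comp_assoc, cap_comp_cup, smul_comp, one_comp]
      have e2 : comp (bar (cupLast (n + 1))) (comp (addStrand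
          (comp (addStrand (jonesWenzl (n + 1)))
            (comp (eLast n) (addStrand (jonesWenzl (n + 1)))))) (cupLast (n + 1))) =
          jonesWenzl (n + 1) := by
        rw [addStrand_comp, addStrand_comp, comp_assoc, comp_assoc, ← cupLast_comp, ← comp_assoc,
          bar_cupLast_comp, eLast, addStrand_comp, comp_assoc, comp_assoc, ← comp_assoc _ (addStrand _),
          zigzag, one_comp, ← comp_assoc (addStrand _), zigzag', one_comp, h1]
      have hq : quantumInt ((n : ℤ) + 2) ≠ 0 := quantumInt_ne_zero (n := n + 2) (by omega)
      have hd := delta_mul_quantumInt ((n : ℤ) + 1)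
      rw [jonesWenzl_succ_succ, addStrand_sub, addStrand_smul, sub_comp, smul_comp, comp_sub,
        comp_smul, e1, e2, ← sub_smul]
      congr 1
      rw [add_assoc, add_assoc] at hd
      push_cast
      rw [add_assoc, add_assoc]
      norm_num at hd ⊢
      rw [eq_div_iff hq, sub_mul, div_mul_cancel₀ _ hq, hd, add_sub_cancel_right]

theorem jonesWenzl_comp_self (n : ℕ) : comp (jonesWenzl n) (jonesWenzl n) = jonesWenzl n := by
  cases n with
  | zero => exact one_comp _
  | succ n => exact (jonesWenzl_aux n).1

theorem jonesWenzl_comp_addStrand (n : ℕ) :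
    comp (jonesWenzl (n + 1)) (addStrand (jonesWenzl n)) = jonesWenzl (n + 1) :=
  (jonesWenzl_aux n).2.1

theorem jonesWenzl_comp_cupLast (n : ℕ) : comp (jonesWenzl (n + 2)) (cupLast n) = 0 :=
  jonesWenzl_comp_cupLast_of (jonesWenzl_aux n).2.1 (jonesWenzl_aux n).2.2

/-- The last elementary diagram factors through the last cup; the earlier ones are killed already by
the smaller projector, which `p_n` absorbs. -/
theorem exists_isElementary (n j : ℕ) (hj : j + 1 < n) : ∃ e : TLDiagram n n,
    TLDiagram.IsElementary e j ∧ comp (jonesWenzl n) (ofDiagram e) = 0 := by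
  induction n with
  | zero => omega
  | succ n ih =>
    cases n with
    | zero => omega
    | succ n =>
      by_cases h : j = n
      · subst h
        refine ⟨_, TLDiagram.isElementary_cupLast j, ?_⟩
        have h1 := comp_ofDiagram (TLDiagram.cupLast j) (TLDiagram.cupLast j).flip
        rw [(TLDiagram.comp_cupLast _).1, pow_zero, one_smul] at h1
        rw [← h1, ← comp_assoc]
        exact (congrArg (fun x => comp x _) (jonesWenzl_comp_cupLast j)).trans (zero_comp _)
      · obtain ⟨e, he, h0⟩ := ih (by omega)
        refine ⟨e.addStrand, he.addStrand (by omega), ?_⟩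
        rw [← jonesWenzl_comp_addStrand, ← addStrand_ofDiagram, comp_assoc, ← addStrand_comp, h0,
          addStrand_zero, comp_zero]

/-- Such a diagram `D` has a cup on two neighbouring top points, so `e D = (q + q⁻¹) D` for an
elementary `e` with `p_n e = 0`; the loop value can be cancelled. -/
theorem jonesWenzl_comp_of_lt {l n : ℕ} (h : l < n) (c : TL l n) : comp (jonesWenzl n) c = 0 := by
  induction c using induction_linear with
  | h0 => exact comp_zero _
  | hadd a b ha hb => rw [comp_add, ha, hb, add_zero]
  | hsmul r D =>
    obtain ⟨i, i', hi, hD⟩ := TLDiagram.exists_adjacent_cup D h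
    obtain ⟨e, he, h0⟩ := exists_isElementary n i (by omega)
    obtain ⟨h1, h2⟩ := he.comp_eq D i i' rfl hi hD
    have h3 := comp_ofDiagram e D
    rw [h1, h2, pow_one] at h3
    have h4 : (qVar + qVar⁻¹) • comp (jonesWenzl n) (ofDiagram D) = 0 := by
      rw [← comp_smul, ← h3, ← comp_assoc, h0, zero_comp]
    rw [comp_smul, (smul_eq_zero.1 h4).resolve_left delta_ne_zero, smul_zero]

/-! ### Through-degrees -/

theorem diagramThroughDegree_le {n m l : ℕ} {D : TLDiagram n m} (b : TL n l) (c : TL l m)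
    (h : ofDiagram D = comp c b) : diagramThroughDegree D ≤ l :=
  Nat.sInf_le ⟨b, c, h⟩

theorem exists_eq_comp {n m : ℕ} (D : TLDiagram n m) :
    ∃ (b : TL n (diagramThroughDegree D)) (c : TL (diagramThroughDegree D) m),
      ofDiagram D = comp c b :=
  Nat.sInf_mem (s := {l : ℕ | ∃ (b : TL n l) (c : TL l m), ofDiagram D = comp c b})
    ⟨n, one n, ofDiagram D, (comp_one _).symm⟩

/-- A factorisation of `D` extends by `E`; the circles only contribute an invertible scalar. -/
theorem diagramThroughDegree_comp_le {n m l : ℕ} (D : TLDiagram n m) (E : TLDiagram m l) :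
    diagramThroughDegree (TLDiagram.comp D E) ≤ diagramThroughDegree D := by
  obtain ⟨b, c, h⟩ := exists_eq_comp D
  have h1 := comp_ofDiagram E D
  refine diagramThroughDegree_le b
    (((qVar + qVar⁻¹) ^ TLDiagram.loops D E)⁻¹ • comp (ofDiagram E) c) ?_
  rw [smul_comp, comp_assoc, ← h, h1, smul_smul, inv_mul_cancel₀ (pow_ne_zero _ delta_ne_zero),
    one_smul]

theorem diagramThroughDegree_flip_le {n m : ℕ} (D : TLDiagram n m) :
    diagramThroughDegree D.flip ≤ diagramThroughDegree D := by
  obtain ⟨b, c, h⟩ := exists_eq_comp D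
  exact diagramThroughDegree_le (bar c) (bar b) (by rw [← bar_comp, ← h, bar_ofDiagram])

theorem diagramThroughDegree_le_left {n m : ℕ} (D : TLDiagram n m) : diagramThroughDegree D ≤ n :=
  diagramThroughDegree_le (one n) (ofDiagram D) (comp_one _).symm

/-- Factorisations in the definition of through-degree involve linear combinations; the coefficient
of the identity diagram excludes these as well. -/
theorem comp_apply_id_eq_zero {n m : ℕ} (h : m < n) (b : TL n m) (c : TL m n) :
    comp c b (TLDiagram.id n) = 0 := by
  induction c using induction_linear with
  | h0 => rw [zero_comp, Finsupp.zero_apply]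
  | hadd a a' h h' => rw [add_comp, Finsupp.add_apply, h, h', add_zero]
  | hsmul r E =>
    induction b using induction_linear with
    | h0 => rw [comp_zero, Finsupp.zero_apply]
    | hadd a a' h h' => rw [comp_add, Finsupp.add_apply, h, h', add_zero]
    | hsmul s D =>
      rw [comp_smul, smul_comp, comp_ofDiagram]
      simp only [Finsupp.smul_apply, ofDiagram]
      rw [Finsupp.single_eq_of_ne' (TLDiagram.comp_ne_id D E h)]
      simp

theorem diagramThroughDegree_id (n : ℕ) : diagramThroughDegree (TLDiagram.id n) = n := by
  refine le_antisymm (diagramThroughDegree_le_left _) ?_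
  by_contra hlt
  obtain ⟨b, c, h⟩ := exists_eq_comp (TLDiagram.id n)
  have h1 := comp_apply_id_eq_zero (not_le.1 hlt) b c
  rw [← h, ofDiagram, Finsupp.single_eq_same] at h1
  exact one_ne_zero h1

theorem throughDegree_le_iff {n m : ℕ} {a : TL n m} {d : WithBot ℕ} :
    throughDegree a ≤ d ↔ ∀ D, a D ≠ 0 → (diagramThroughDegree D : WithBot ℕ) ≤ d := by
  rw [throughDegree, Finset.sup_le_iff]
  simp only [Finsupp.mem_support_iff]

theorem le_throughDegree {n m : ℕ} {a : TL n m} {D : TLDiagram n m} (h : a D ≠ 0) :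
    (diagramThroughDegree D : WithBot ℕ) ≤ throughDegree a :=
  throughDegree_le_iff.1 le_rfl D h

theorem throughDegree_zero (n m : ℕ) : throughDegree (0 : TL n m) = ⊥ := rfl

theorem throughDegree_add_le {n m : ℕ} {a b : TL n m} {d : WithBot ℕ} (ha : throughDegree a ≤ d)
    (hb : throughDegree b ≤ d) : throughDegree (a + b) ≤ d := by
  rw [throughDegree_le_iff]
  intro D hD
  by_cases h : a D = 0
  · refine (le_throughDegree (a := b) fun h' => hD ?_).trans hb
    rw [Finsupp.add_apply, h, h', add_zero]
  · exact (le_throughDegree h).trans ha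

theorem throughDegree_smul_le {n m : ℕ} (r : RatFunc ℂ) (a : TL n m) :
    throughDegree (r • a) ≤ throughDegree a := by
  rw [throughDegree_le_iff]
  intro D hD
  refine le_throughDegree fun h => hD ?_
  rw [Finsupp.smul_apply, h, smul_zero]

theorem throughDegree_sum_le {n m : ℕ} {ι : Type} {s : Finset ι} {f : ι → TL n m} {d : WithBot ℕ}
    (h : ∀ i ∈ s, throughDegree (f i) ≤ d) : throughDegree (∑ i ∈ s, f i) ≤ d :=
  Finset.sum_induction f (fun a => throughDegree a ≤ d) (fun _ _ => throughDegree_add_le)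
    (by rw [throughDegree_zero]; exact bot_le) h

theorem throughDegree_neg {n m : ℕ} (a : TL n m) : throughDegree (-a) = throughDegree a := by
  rw [throughDegree, throughDegree, Finsupp.support_neg]

theorem throughDegree_ofDiagram {n m : ℕ} (D : TLDiagram n m) :
    throughDegree (ofDiagram D) = diagramThroughDegree D := by
  rw [throughDegree, ofDiagram, Finsupp.support_single D one_ne_zero, Finset.sup_singleton]

theorem eq_sum {n m : ℕ} (a : TL n m) : a = ∑ D ∈ a.support, a D • ofDiagram D := by
  conv_lhs => rw [← Finsupp.sum_single a]
  refine Finset.sum_congr rfl fun D _ => ?_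
  rw [ofDiagram, Finsupp.smul_single, smul_eq_mul, mul_one]

theorem throughDegree_bar_le {n m : ℕ} (a : TL n m) : throughDegree (bar a) ≤ throughDegree a := by
  rw [throughDegree_le_iff]
  intro D hD
  rw [← D.flip_flip, bar, Finsupp.mapDomain_apply
    (Function.LeftInverse.injective TLDiagram.flip_flip)] at hD
  refine le_trans ?_ (le_throughDegree hD)
  nth_rw 1 [← D.flip_flip]
  exact WithBot.coe_le_coe.2 (diagramThroughDegree_flip_le _)

theorem throughDegree_bar {n m : ℕ} (a : TL n m) : throughDegree (bar a) = throughDegree a := by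
  refine le_antisymm (throughDegree_bar_le a) ?_
  nth_rw 1 [← bar_bar a]
  exact throughDegree_bar_le _

theorem throughDegree_comp_le_right {n m l : ℕ} (b : TL m l) (a : TL n m) :
    throughDegree (comp b a) ≤ throughDegree a := by
  rw [eq_sum b, sum_comp]
  refine throughDegree_sum_le fun E _ => ?_
  nth_rw 1 [eq_sum a]
  rw [comp_sum]
  refine throughDegree_sum_le fun D hD => ?_
  rw [comp_smul, smul_comp, comp_ofDiagram, smul_smul, smul_smul]
  refine (throughDegree_smul_le _ _).trans ?_
  rw [throughDegree_ofDiagram]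
  exact (WithBot.coe_le_coe.2 (diagramThroughDegree_comp_le D E)).trans
    (le_throughDegree (Finsupp.mem_support_iff.1 hD))

theorem throughDegree_comp_le_left {n m l : ℕ} (b : TL m l) (a : TL n m) :
    throughDegree (comp b a) ≤ throughDegree b := by
  rw [← throughDegree_bar, bar_comp, ← throughDegree_bar b]
  exact throughDegree_comp_le_right _ _

theorem throughDegree_le_left {n m : ℕ} (a : TL n m) : throughDegree a ≤ n :=
  throughDegree_le_iff.2 fun D _ => WithBot.coe_le_coe.2 (diagramThroughDegree_le_left D)

theorem throughDegree_le_right {n m : ℕ} (a : TL n m) : throughDegree a ≤ m := by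
  rw [← throughDegree_bar]
  exact throughDegree_le_left _

theorem jonesWenzl_comp_of_throughDegree_lt {l k : ℕ} (a : TL l k)
    (h : throughDegree a < (k : WithBot ℕ)) : comp (jonesWenzl k) a = 0 := by
  rw [eq_sum a, comp_sum]
  refine Finset.sum_eq_zero fun D hD => ?_
  have h1 := (le_throughDegree (Finsupp.mem_support_iff.1 hD)).trans_lt h
  obtain ⟨b, c, h2⟩ := exists_eq_comp D
  rw [comp_smul, h2, ← comp_assoc, jonesWenzl_comp_of_lt (Nat.cast_lt.1 h1), zero_comp,
    smul_zero]

theorem comp_jonesWenzl_of_throughDegree_lt {l k : ℕ} (a : TL k l)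
    (h : throughDegree a < (k : WithBot ℕ)) : comp a (jonesWenzl k) = 0 := by
  have h1 := jonesWenzl_comp_of_throughDegree_lt (bar a) (by rwa [throughDegree_bar])
  have h2 := congrArg bar h1
  rwa [bar_comp, bar_bar, bar_jonesWenzl, bar_zero] at h2

end TL

/-! ### Sign sequences: appending an entry -/

theorem SignSeq.size_snoc {n : ℕ} (ε : SignSeq n) (s : ℤˣ) :
    SignSeq.size (Fin.snoc ε s : SignSeq (n + 1)) = ε.size + s := by
  rw [size, size, Fin.sum_univ_castSucc]
  simp

theorem SignSeq.sum_Iic_last {n : ℕ} (ε : SignSeq (n + 1)) :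
    ∑ i ∈ Finset.Iic (Fin.last n), (ε i : ℤ) = ε.size := by
  rw [size]
  congr 1
  ext i
  simp [Fin.le_last]

theorem SignSeq.Admissible.size_nonneg {n : ℕ} {ε : SignSeq n} (h : ε.Admissible) :
    0 ≤ ε.size := by
  cases n with
  | zero => simp [size]
  | succ n =>
    rw [← sum_Iic_last]
    exact h _

theorem SignSeq.size_le {n : ℕ} (ε : SignSeq n) : ε.size ≤ n := by
  have h : ∀ i ∈ (Finset.univ : Finset (Fin n)), (ε i : ℤ) ≤ 1 := by
    intro i _
    rcases Int.units_eq_one_or (ε i) with h | h <;> simp [h]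
  refine (Finset.sum_le_sum h).trans ?_
  simp

theorem SignSeq.admissible_snoc {n : ℕ} (ε : SignSeq n) (s : ℤˣ) :
    SignSeq.Admissible (Fin.snoc ε s : SignSeq (n + 1)) ↔ ε.Admissible ∧ 0 ≤ ε.size + s := by
  have h1 : ∀ j : Fin n, ∑ i ∈ Finset.Iic j.castSucc, ((Fin.snoc ε s : SignSeq (n + 1)) i : ℤ) =
      ∑ i ∈ Finset.Iic j, (ε i : ℤ) := by
    intro j
    rw [← Fin.map_castSuccEmb_Iic, Finset.sum_map]
    simp
  rw [Admissible, Fin.forall_fin_succ', sum_Iic_last, size_snoc]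
  simp only [h1, Admissible]

namespace TL

/-! ### Higher order projectors -/

theorem topHalf_snoc_one {n : ℕ} (k : ℕ) (ε : SignSeq n) :
    topHalf (n + 1) (k + 1) (Fin.snoc ε 1 : SignSeq (n + 1)) =
      comp (addStrand (topHalf n k ε)) (jonesWenzl (k + 1)) := by
  rw [topHalf, if_pos (Fin.snoc_last _ _), Fin.init_snoc]

theorem topHalf_snoc_neg_one {n : ℕ} (k : ℕ) (ε : SignSeq n) :
    topHalf (n + 1) k (Fin.snoc ε (-1) : SignSeq (n + 1)) =
      comp (addStrand (topHalf n (k + 1) ε))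
        (comp (addStrand (jonesWenzl (k + 1))) (cupLast k)) := by
  rw [topHalf.eq_def]
  simp only
  rw [if_neg (by rw [Fin.snoc_last]; decide), Fin.init_snoc]

/-- After a step `+1` this is idempotence. After a step `-1`, `p_k` slides past the cup as `p_k ⊔ 1
⊔ 1` and is absorbed by `p_{k+1} ⊔ 1`. -/
theorem topHalf_comp_jonesWenzl (n k : ℕ) (ε : SignSeq n) :
    comp (topHalf n k ε) (jonesWenzl k) = topHalf n k ε := by
  cases n with
  | zero =>
    cases k with
    | zero => exact comp_one _
    -- The empty sequence does not have size `k + 1`: the top half has the default value `0`.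
    | succ k => exact zero_comp _
  | succ n =>
    rw [topHalf.eq_def]
    simp only
    split_ifs
    · cases k with
      | zero => exact zero_comp _
      | succ k =>
        simp only
        rw [comp_assoc, jonesWenzl_comp_self]
    · rw [comp_assoc, comp_assoc, cupLast_comp, ← comp_assoc (addStrand (jonesWenzl _)),
        ← addStrand_comp, jonesWenzl_comp_addStrand]

theorem specialElement_eq (n k : ℕ) (ε : SignSeq n) :
    specialElement n k ε =
      comp (topHalf n k ε) (comp (jonesWenzl k) (bar (topHalf n k ε))) := by
  rw [← comp_assoc, topHalf_comp_jonesWenzl, specialElement]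

theorem bar_seqProjector (n k : ℕ) (ε : SignSeq n) :
    bar (seqProjector n k ε) = seqProjector n k ε := by
  rw [seqProjector, bar_smul, specialElement, bar_comp, bar_bar]

/-- With `p_k` inserted in the middle of `p_ε`, the factor `a t_ε` lies in `TL(k, l)` and has
through-degree less than `k`, so `p_k` kills it. -/
theorem comp_seqProjector_eq_zero {n k l : ℕ} (ε : SignSeq n) (a : TL n l)
    (h : throughDegree a < (k : WithBot ℕ)) : comp a (seqProjector n k ε) = 0 := by
  rw [seqProjector, comp_smul, specialElement_eq, ← comp_assoc, ← comp_assoc,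
    comp_jonesWenzl_of_throughDegree_lt _ ((throughDegree_comp_le_left _ _).trans_lt h),
    zero_comp, smul_zero]

theorem throughDegree_seqProjector_le (n k : ℕ) (ε : SignSeq n) :
    throughDegree (seqProjector n k ε) ≤ k :=
  (throughDegree_smul_le _ _).trans
    ((throughDegree_comp_le_left _ _).trans (throughDegree_le_left _))

theorem scalar_snoc_one {n : ℕ} (ε : SignSeq n) :
    scalar (n + 1) (Fin.snoc ε 1 : SignSeq (n + 1)) = scalar n ε := by
  rw [scalar, if_pos (Fin.snoc_last _ _), Fin.init_snoc]

theorem scalar_snoc_neg_one {n : ℕ} (ε : SignSeq n) :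
    scalar (n + 1) (Fin.snoc ε (-1) : SignSeq (n + 1)) =
      scalar n ε * (quantumInt ε.size / quantumInt (ε.size + 1)) := by
  rw [scalar, if_neg (by rw [Fin.snoc_last]; decide), Fin.init_snoc]

theorem seqProjector_snoc_one {n : ℕ} (k : ℕ) (ε : SignSeq n) :
    seqProjector (n + 1) (k + 1) (Fin.snoc ε 1 : SignSeq (n + 1)) =
      scalar n ε • comp (addStrand (topHalf n k ε))
        (comp (jonesWenzl (k + 1)) (addStrand (bar (topHalf n k ε)))) := by
  rw [seqProjector, scalar_snoc_one, specialElement, topHalf_snoc_one, bar_comp, bar_jonesWenzl,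
    bar_addStrand, comp_assoc, ← comp_assoc (jonesWenzl _), jonesWenzl_comp_self]

theorem seqProjector_snoc_neg_one {n : ℕ} (k : ℕ) (ε : SignSeq n) (h : ε.size = (k : ℤ) + 1) :
    seqProjector (n + 1) k (Fin.snoc ε (-1) : SignSeq (n + 1)) =
      (scalar n ε * (quantumInt (k + 1) / quantumInt (k + 2))) •
        comp (addStrand (topHalf n (k + 1) ε))
          (comp (comp (addStrand (jonesWenzl (k + 1)))
            (comp (eLast k) (addStrand (jonesWenzl (k + 1)))))
              (addStrand (bar (topHalf n (k + 1) ε)))) := by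
  rw [seqProjector, scalar_snoc_neg_one, h, add_assoc, one_add_one_eq_two, specialElement,
    topHalf_snoc_neg_one, bar_comp, bar_comp, bar_addStrand, bar_addStrand, bar_jonesWenzl, eLast]
  simp only [comp_assoc]

theorem addStrand_seqProjector (n k : ℕ) (ε : SignSeq n) :
    addStrand (seqProjector n k ε) =
      scalar n ε • comp (addStrand (topHalf n k ε))
        (comp (addStrand (jonesWenzl k)) (addStrand (bar (topHalf n k ε)))) := by
  rw [seqProjector, addStrand_smul, specialElement_eq, addStrand_comp, addStrand_comp]

/-- At size `0` only the step `+1` is admissible, and `p_0 ⊔ 1 = p_1`. -/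
theorem addStrand_seqProjector_zero (n : ℕ) (ε : SignSeq n) :
    addStrand (seqProjector n 0 ε) =
      seqProjector (n + 1) 1 (Fin.snoc ε 1 : SignSeq (n + 1)) := by
  rw [seqProjector_snoc_one 0 ε, addStrand_seqProjector]
  congr 3
  exact addStrand_one 0

/-- This is Wenzl's recurrence for `p_{k+2}`, solved for `p_{k+1} ⊔ 1` and sandwiched between `t_ε ⊔
1` and its reflection. The scalars `f_ε` are made to match its coefficient. -/
theorem addStrand_seqProjector_succ (n k : ℕ) (ε : SignSeq n) (h : ε.size = (k : ℤ) + 1) :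
    addStrand (seqProjector n (k + 1) ε) =
      seqProjector (n + 1) (k + 2) (Fin.snoc ε 1 : SignSeq (n + 1)) +
        seqProjector (n + 1) k (Fin.snoc ε (-1) : SignSeq (n + 1)) := by
  rw [seqProjector_snoc_one (k + 1) ε, seqProjector_snoc_neg_one k ε h, addStrand_seqProjector,
    jonesWenzl_succ_succ, sub_comp, comp_sub, smul_sub, smul_comp, comp_smul, smul_smul,
    sub_add_cancel]

/-! ### Decomposition of the identity -/

/-- The idempotent of a sequence, extended by `0` to the sequences that are not admissible. -/
noncomputable def admissibleProjector (n : ℕ) (ε : SignSeq n) : TL n n :=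
  if ε.Admissible then seqProjector n ε.size.toNat ε else 0

theorem admissibleProjector_snoc_add {n : ℕ} (ε : SignSeq n) :
    admissibleProjector (n + 1) (Fin.snoc ε 1 : SignSeq (n + 1)) +
      admissibleProjector (n + 1) (Fin.snoc ε (-1) : SignSeq (n + 1)) =
        addStrand (admissibleProjector n ε) := by
  unfold admissibleProjector
  simp only [SignSeq.admissible_snoc, SignSeq.size_snoc]
  by_cases h : ε.Admissible
  · obtain ⟨k, hk⟩ := Int.eq_ofNat_of_zero_le h.size_nonneg
    simp only [h, true_and, if_true, hk]
    have e1 : ((k : ℤ) + (1 : ℤˣ)).toNat = k + 1 := by simp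
    rw [if_pos (by simp; omega), e1]
    cases k with
    | zero =>
      rw [if_neg (by simp), add_zero]
      exact (addStrand_seqProjector_zero n ε).symm
    | succ k =>
      have e2 : (((k + 1 : ℕ) : ℤ) + ((-1 : ℤˣ) : ℤ)).toNat = k := by simp
      rw [if_pos (by simp), e2]
      exact (addStrand_seqProjector_succ n k ε (by rw [hk]; push_cast; rfl)).symm
  · simp [h, addStrand_zero]

theorem sum_admissibleProjector (n : ℕ) : ∑ ε, admissibleProjector n ε = one n := by
  induction n with
  | zero =>
    rw [Fintype.sum_unique, admissibleProjector, if_pos (show SignSeq.Admissible _ from fun j => j.elim0), SignSeq.size,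
      Finset.univ_eq_empty, Finset.sum_empty, Int.toNat_zero, seqProjector, scalar, specialElement,
      topHalf, bar_one, one_comp, one_smul]
  | succ n ih =>
    rw [← (Fin.snocEquiv fun _ : Fin (n + 1) => ℤˣ).sum_comp, Fintype.sum_prod_type,
      Finset.sum_comm, ← addStrand_one, ← ih, addStrand_sum]
    refine Finset.sum_congr rfl fun ε _ => ?_
    rw [← admissibleProjector_snoc_add]
    -- The units of `ℤ` are enumerated as `1` and `-1`.
    exact Finset.sum_pair (by decide)

/-- An admissible sequence of length `n` has a size between `0` and `n`, so grouping by size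
exhausts the decomposition of `1_n`. -/
theorem sum_higherJonesWenzl (n : ℕ) : ∑ k ∈ Finset.range (n + 1), higherJonesWenzl n k = one n := by
  rw [← sum_admissibleProjector]
  unfold higherJonesWenzl SignSeq.admissible
  simp only [Finset.sum_filter]
  rw [Finset.sum_comm]
  refine Finset.sum_congr rfl fun ε _ => ?_
  unfold admissibleProjector
  by_cases h : ε.Admissible
  · obtain ⟨k, hk⟩ := Int.eq_ofNat_of_zero_le h.size_nonneg
    have := ε.size_le
    simp only [h, true_and, if_true, hk]
    rw [Finset.sum_eq_single k]
    · simp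
    · intro j _ hj
      rw [if_neg]
      exact_mod_cast hj.symm
    · intro hn
      rw [Finset.mem_range] at hn
      omega
  · simp [h]

theorem bar_sum {n m : ℕ} {ι : Type} (s : Finset ι) (f : ι → TL n m) :
    bar (∑ i ∈ s, f i) = ∑ i ∈ s, bar (f i) :=
  Finsupp.mapDomain_finsetSum

theorem bar_higherJonesWenzl (n k : ℕ) : bar (higherJonesWenzl n k) = higherJonesWenzl n k := by
  rw [higherJonesWenzl, bar_sum]
  simp only [bar_seqProjector]

theorem comp_higherJonesWenzl_eq_zero {n k l : ℕ} (a : TL n l)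
    (h : throughDegree a < (k : WithBot ℕ)) : comp a (higherJonesWenzl n k) = 0 := by
  rw [higherJonesWenzl, comp_sum]
  exact Finset.sum_eq_zero fun ε _ => comp_seqProjector_eq_zero ε a h

theorem higherJonesWenzl_comp_eq_zero {n k l : ℕ} (a : TL l n)
    (h : throughDegree a < (k : WithBot ℕ)) : comp (higherJonesWenzl n k) a = 0 := by
  have h1 := congrArg bar (comp_higherJonesWenzl_eq_zero (bar a) (by rwa [throughDegree_bar]))
  rwa [bar_comp, bar_bar, bar_higherJonesWenzl, bar_zero] at h1

theorem throughDegree_higherJonesWenzl_le (n k : ℕ) :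
    throughDegree (higherJonesWenzl n k) ≤ k :=
  throughDegree_sum_le fun ε _ => throughDegree_seqProjector_le n k ε

/-! ### The three properties and uniqueness -/

theorem throughDegree_add_lt {n m : ℕ} {a b : TL n m} {d : WithBot ℕ} (ha : throughDegree a < d)
    (hb : throughDegree b < d) : throughDegree (a + b) < d :=
  (throughDegree_add_le (le_max_left _ _) (le_max_right _ _)).trans_lt (max_lt ha hb)

theorem throughDegree_sum_lt {n m : ℕ} {ι : Type} {s : Finset ι} {f : ι → TL n m} {d : WithBot ℕ}
    (hd : ⊥ < d) (h : ∀ i ∈ s, throughDegree (f i) < d) : throughDegree (∑ i ∈ s, f i) < d :=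
  Finset.sum_induction f (fun a => throughDegree a < d) (fun _ _ => throughDegree_add_lt)
    (by rwa [throughDegree_zero]) h

/-- On elements of through-degree at most `k`, right multiplication by `p_{n,k}` is the identity
up to elements of smaller through-degree. -/
theorem exists_comp_higherJonesWenzl_eq {n k l : ℕ} (hkn : k ≤ n) (a : TL n l)
    (h : throughDegree a ≤ k) :
    ∃ b : TL n l, comp a (higherJonesWenzl n k) = a + b ∧ throughDegree b < (k : WithBot ℕ) := by
  -- The correction term is minus the part of `a = ∑ j, a p_{n,j}` with `j < k`; the part with `j >
  -- k` vanishes.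
  refine ⟨-∑ j ∈ Finset.range k, comp a (higherJonesWenzl n j), ?_, ?_⟩
  · have h1 : a = ∑ j ∈ Finset.range (n + 1), comp a (higherJonesWenzl n j) := by
      rw [← comp_sum, sum_higherJonesWenzl, comp_one]
    have h2 : ∑ j ∈ Finset.range (n + 1), comp a (higherJonesWenzl n j) =
        ∑ j ∈ Finset.range (k + 1), comp a (higherJonesWenzl n j) := by
      refine (Finset.sum_subset (Finset.range_subset_range.2 (by omega)) fun j _ hj => ?_).symm
      rw [Finset.mem_range] at hj
      exact comp_higherJonesWenzl_eq_zero a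
        (h.trans_lt (WithBot.coe_lt_coe.2 (show k < j by omega)))
    rw [h2, Finset.sum_range_succ] at h1
    nth_rw 2 [h1]
    abel
  · rw [throughDegree_neg]
    refine throughDegree_sum_lt (WithBot.bot_lt_coe k) fun j hj => ?_
    refine ((throughDegree_comp_le_right _ _).trans
      (throughDegree_higherJonesWenzl_le n j)).trans_lt ?_
    exact WithBot.coe_lt_coe.2 (Finset.mem_range.1 hj)

theorem throughDegree_one (n : ℕ) : throughDegree (one n) = n := by
  rw [one, throughDegree_ofDiagram, diagramThroughDegree_id]

/-- Nested caps give an element of `TL(k + 2r, k)` with a right inverse up to a scalar. -/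
theorem exists_comp_bar_eq (k r : ℕ) :
    ∃ a : TL (k + 2 * r) k, comp a (bar a) = (qVar + qVar⁻¹) ^ r • one k := by
  induction r with
  | zero => exact ⟨one k, by
      rw [pow_zero, one_smul]
      exact (congrArg (comp (one k)) (bar_one k)).trans (one_comp _)⟩
  | succ r ih =>
    obtain ⟨a, ha⟩ := ih
    refine ⟨comp a (bar (cupLast (k + 2 * r))), ?_⟩
    rw [bar_comp, bar_bar, comp_assoc, ← comp_assoc (bar (cupLast _)), cap_comp_cup, smul_comp,
      one_comp, comp_smul, ha, smul_smul, pow_succ']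

/-- For the nested caps `a`, the identity `1_k` is a multiple of `a ā`, so `k = τ(1_k) ≤ τ(a)`. -/
theorem exists_throughDegree_eq {n k : ℕ} (hkn : k ≤ n) (hpar : Even (n - k)) :
    ∃ a : TL n k, throughDegree a = k := by
  obtain ⟨r, hr⟩ := hpar
  obtain rfl : n = k + 2 * r := by omega
  obtain ⟨a, ha⟩ := exists_comp_bar_eq k r
  refine ⟨a, le_antisymm (throughDegree_le_right a) ?_⟩
  have h1 : one k = ((qVar + qVar⁻¹) ^ r)⁻¹ • comp a (bar a) := by
    rw [ha, smul_smul, inv_mul_cancel₀ (pow_ne_zero _ delta_ne_zero), one_smul]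
  rw [← throughDegree_one k, h1]
  exact (throughDegree_smul_le _ _).trans (throughDegree_comp_le_left _ _)

/-- If `τ(p_{n,k})` were less than `k`, then `a = a p_{n,k} - b` would have through-degree less than
`k` for every `a` with `τ(a) = k`; parity provides such an `a`. For `n - k` odd, `p_{n,k}` would be
`0`. -/
theorem throughDegree_higherJonesWenzl {n k : ℕ} (hkn : k ≤ n) (hpar : Even (n - k)) :
    throughDegree (higherJonesWenzl n k) = k := by
  refine le_antisymm (throughDegree_higherJonesWenzl_le n k) ?_
  obtain ⟨a, ha⟩ := exists_throughDegree_eq hkn hpar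
  obtain ⟨b, hb, hb'⟩ := exists_comp_higherJonesWenzl_eq hkn a ha.le
  by_contra hlt
  rw [not_le] at hlt
  have h1 : a = comp a (higherJonesWenzl n k) + -b := by
    rw [hb]
    abel
  have h2 : throughDegree a < (k : WithBot ℕ) := by
    rw [h1]
    exact throughDegree_add_lt ((throughDegree_comp_le_right _ _).trans_lt hlt)
      (by rwa [throughDegree_neg])
  exact h2.ne ha

/-- An element that is killed from the left by the elements of through-degree less than `k` is
fixed by `p_{n,k}` if its through-degree is at most `k`. -/
theorem higherJonesWenzl_comp_eq_self {n k l : ℕ} (hkn : k ≤ n) (d : TL l n)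
    (hd : throughDegree d ≤ k)
    (h : ∀ a : TL n n, throughDegree a < (k : WithBot ℕ) → comp a d = 0) :
    comp (higherJonesWenzl n k) d = d := by
  have h1 : d = ∑ j ∈ Finset.range (n + 1), comp (higherJonesWenzl n j) d := by
    rw [← sum_comp, sum_higherJonesWenzl, one_comp]
  rw [Finset.sum_eq_single k] at h1
  · exact h1.symm
  · intro j _ hj
    -- Below `k` the projector `p_{n,j}` kills `d` by assumption; above `k` it kills `d` because
    -- `τ(d) ≤ k < j`.
    rcases lt_or_gt_of_ne hj with hj | hj
    · exact h _ ((throughDegree_higherJonesWenzl_le n j).trans_lt (WithBot.coe_lt_coe.2 hj))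
    · exact higherJonesWenzl_comp_eq_zero d (hd.trans_lt (WithBot.coe_lt_coe.2 hj))
  · intro hn
    rw [Finset.mem_range] at hn
    omega

end TL

theorem mainTheorem8 (n k : ℕ) (hkn : k ≤ n) (hpar : Even (n - k)) (p : TL n n) :
    ((TL.throughDegree p = (k : WithBot ℕ)) ∧
      (∀ (l : ℕ) (a : TL n l), TL.throughDegree a < (k : WithBot ℕ) →
        TL.comp a p = 0 ∧ TL.comp p (TL.bar a) = 0) ∧
      (∀ (l : ℕ) (a : TL n l), TL.throughDegree a = (k : WithBot ℕ) →
        ∃ b : TL n l, TL.comp a p = a + b ∧ TL.throughDegree b < (k : WithBot ℕ))) ↔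
    p = TL.higherJonesWenzl n k := by
  have ht := TL.throughDegree_higherJonesWenzl hkn hpar
  constructor
  · rintro ⟨h1, h2, h3⟩
    have hd : TL.throughDegree (p - TL.higherJonesWenzl n k) ≤ k := by
      rw [sub_eq_add_neg]
      exact TL.throughDegree_add_le h1.le (by rw [TL.throughDegree_neg, ht])
    -- Elements of through-degree less than `k` kill `p` and `p_{n,k}`, hence their difference `d`;
    -- therefore `p_{n,k} d = d`.
    have hfix := TL.higherJonesWenzl_comp_eq_self hkn _ hd fun a ha => by
      rw [TL.comp_sub, (h2 n a ha).1, TL.comp_higherJonesWenzl_eq_zero a ha, sub_zero]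
    -- Property 3 is applied to `a = p_{n,k}`, for `p` and for `p_{n,k}` itself; the leading terms
    -- cancel in `p_{n,k} d`.
    obtain ⟨b, hb, hb'⟩ := h3 n _ ht
    obtain ⟨c, hc, hc'⟩ := TL.exists_comp_higherJonesWenzl_eq hkn _ ht.le
    have hlt : TL.throughDegree (p - TL.higherJonesWenzl n k) < (k : WithBot ℕ) := by
      rw [← hfix, TL.comp_sub, hb, hc, add_sub_add_left_eq_sub, sub_eq_add_neg]
      exact TL.throughDegree_add_lt hb' (by rwa [TL.throughDegree_neg])
    -- Now `τ(d) < k`, so `p_{n,k} d = 0` as well as `p_{n,k} d = d`.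
    rw [TL.higherJonesWenzl_comp_eq_zero _ hlt] at hfix
    exact sub_eq_zero.1 hfix.symm
  · rintro rfl
    refine ⟨ht, fun l a ha => ⟨TL.comp_higherJonesWenzl_eq_zero a ha,
      TL.higherJonesWenzl_comp_eq_zero _ (by rwa [TL.throughDegree_bar])⟩,
      fun l a ha => TL.exists_comp_higherJonesWenzl_eq hkn a ha.le⟩
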